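/- Let $g\ge 1$, and let $H$ be a free abelian group of rank $2g$ with a unimodular alternating form $\theta:H\times H\to\mathbb Z$. Let $a_1,\dots,a_{2g+1}\in H$ be a chain: $\theta(a_i,a_{i+1})=\pm1$ for all $i$, and $\theta(a_i,a_j)=0$ whenever $|i-j|\ge 2$. (For example, $H=H_1(C_g,\mathbb Z)$ with the intersection form, where $C_g$ is a closed oriented surface of genus $g$ and $a_i$ is the homology class of the $i$-th loop in the standard chain of $2g+1$ simple closed curves on $C_g$.) Let $$B_{2g+2}=\langle t_1,\dots,t_{2g+1}\mid t_it_j=t_jt_i\ (|i-j|\ge2),\ t_it_{i+1}t_i=t_{i+1}t_it_{i+1}\rangle$$ be the braid group on $2g+2$ strands, and let $\sigma_g:B_{2g+2}\to Sp(H,\theta)$ be the homomorphism that sends $t_i$ to the symplectic transvection $x\mapsto x+\theta(a_i,x)a_i$ (for $H=H_1(C_g,\mathbb Z)$, the action on homology of the Dehn twist about the $i$-th loop). Put $H_{\mathbb R}=H\otimes\mathbb R$, extend $\theta$ to $H_{\mathbb R}$ bilinearly, let $\pi:\widetilde{Sp}(H_{\mathbb R},\theta)\to Sp(H_{\mathbb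 R},\theta)$ be the universal cover of the real symplectic group, and let $\widetilde{Sp}(H,\theta)=\pi^{-1}(Sp(H,\theta))$. Let $\widetilde\Lambda(H_{\mathbb R},\theta)$ be the universal cover of the Grassmannian of Lagrangian subspaces of $H_{\mathbb R}$, with the natural action of $\widetilde{Sp}(H_{\mathbb R},\theta)$. Then: 1. $\pi$ is part of a central extension $0\to\mathbb Z\to\widetilde{Sp}(H_{\mathbb R},\theta)\to Sp(H_{\mathbb R},\theta)\to1$, and the pullback of this extension to $B_{2g+2}$ along $\sigma_g:B_{2g+2}\to Sp(H,\theta)\subset Sp(H_{\mathbb R},\theta)$ is a split extension. 2. There is a homomorphism $\tilde\sigma_g:B_{2g+2}\to\widetilde{Sp}(H,\theta)$ with $\pi\circ\tilde\sigma_g=\sigma_g$ such that, for every $i$, $\tilde\sigma_g(t_i)$ is the unique lift of $\sigma_g(t_i)$ to $\widetilde{Sp}(H_{\mathbb R},\theta)$ that acts with a fixed point on $\widetilde\Lambda(H_{\mathbb R},\theta)$. -/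

import Mathlib

open scoped TensorProduct unitInterval

noncomputable section

/-! ### Universal covers by homotopy classes of paths -/

namespace PathCover

variable {X : Type*} [TopologicalSpace X]

/-- Continuous paths `[0,1] → X` starting at `x₀`. -/
abbrev BasedPath (X : Type*) [TopologicalSpace X] (x₀ : X) : Type _ := {γ : C(I, X) // γ 0 = x₀}

/-- Two based paths are equivalent when they are homotopic relative to the end points. -/
def basedSetoid (X : Type*) [TopologicalSpace X] (x₀ : X) : Setoid (BasedPath X x₀) where
  r γ δ := ContinuousMap.HomotopicRel γ.1 δ.1 {0, 1}
  iseqv := ⟨fun γ => ContinuousMap.HomotopicRel.refl γ.1, fun h => h.symm, fun h k => h.trans k⟩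

end PathCover

open PathCover

/-- The universal cover of `X` (as a set over `X`), constructed from the base point `x₀`:
homotopy classes, relative to the end points, of paths starting at `x₀`. -/
def UniversalCover (X : Type*) [TopologicalSpace X] (x₀ : X) : Type _ :=
  Quotient (basedSetoid X x₀)

namespace UniversalCover

/-- The covering projection: a class of paths is sent to its end point. -/
def proj {X : Type*} [TopologicalSpace X] {x₀ : X} : UniversalCover X x₀ → X :=
  Quotient.lift (fun γ => γ.1 1) fun _ _ h => h.fst_eq_snd (by simp)

section Action

variable {G : Type*} [Group G] [TopologicalSpace G]
variable {X : Type*} [TopologicalSpace X] [MulAction G X] [ContinuousSMul G X]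

/-- Pointwise action of a path in `G` on a path in `X`. -/
def pathSMul (γ : C(I, G)) (δ : C(I, X)) : C(I, X) := ⟨fun s => γ s • δ s, by fun_prop⟩

theorem pathSMul_homotopicRel {γ γ' : C(I, G)} {δ δ' : C(I, X)} {S : Set I}
    (h : γ.HomotopicRel γ' S) (k : δ.HomotopicRel δ' S) :
    (pathSMul γ δ).HomotopicRel (pathSMul γ' δ') S := by
  obtain ⟨F⟩ := h
  obtain ⟨K⟩ := k
  exact ⟨{  toFun := fun p => F p • K p
            continuous_toFun := by fun_prop
            map_zero_left := fun x => by simp [pathSMul]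
            map_one_left := fun x => by simp [pathSMul]
            prop' := fun t x hx => by
              have h₁ := F.eq_fst t hx
              have h₂ := K.eq_fst t hx
              simp only [pathSMul, ContinuousMap.coe_mk] at h₁ h₂ ⊢
              rw [h₁, h₂] }⟩

end Action

variable {G : Type*} [Group G] [TopologicalSpace G] [IsTopologicalGroup G]
variable {X : Type*} [TopologicalSpace X] [MulAction G X] [ContinuousSMul G X]

theorem pathInv_homotopicRel {γ γ' : C(I, G)} {S : Set I} (h : γ.HomotopicRel γ' S) :
    (γ⁻¹).HomotopicRel (γ'⁻¹) S :=
  h.comp_continuousMap ⟨fun x => x⁻¹, continuous_inv⟩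

/-- The universal cover of a topological group, based at the identity, is a group under pointwise
multiplication of paths. -/
instance instGroup : Group (UniversalCover G (1 : G)) where
  mul := Quotient.map₂ (fun γ δ => ⟨γ.1 * δ.1, by simp [γ.2, δ.2]⟩)
    fun _ _ h _ _ k => pathSMul_homotopicRel (X := G) h k
  one := Quotient.mk _ ⟨1, by simp⟩
  inv := Quotient.map (fun γ => ⟨γ.1⁻¹, by simp [γ.2]⟩) fun _ _ h => pathInv_homotopicRel h
  mul_assoc a b c := by
    induction a using Quotient.inductionOn
    induction b using Quotient.inductionOn
    induction c using Quotient.inductionOn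
    exact congrArg (Quotient.mk _) (Subtype.ext (mul_assoc _ _ _))
  one_mul a := by
    induction a using Quotient.inductionOn
    exact congrArg (Quotient.mk _) (Subtype.ext (one_mul _))
  mul_one a := by
    induction a using Quotient.inductionOn
    exact congrArg (Quotient.mk _) (Subtype.ext (mul_one _))
  inv_mul_cancel a := by
    induction a using Quotient.inductionOn
    exact congrArg (Quotient.mk _) (Subtype.ext (inv_mul_cancel _))

/-- The covering projection of a topological group is a homomorphism. -/
def projHom (G : Type*) [Group G] [TopologicalSpace G] [IsTopologicalGroup G] :
    UniversalCover G (1 : G) →* G where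
  toFun := proj
  map_one' := rfl
  map_mul' a b := by
    induction a using Quotient.inductionOn
    induction b using Quotient.inductionOn
    rfl

/-- If `G` acts continuously on `X`, then the universal cover of `G` acts on the universal cover
of `X`, by `[γ] • [δ] = [s ↦ γ s • δ s]`; this lifts the action of `G` on `X`. -/
instance instMulAction (x₀ : X) : MulAction (UniversalCover G (1 : G)) (UniversalCover X x₀) where
  smul := Quotient.map₂ (fun γ δ => ⟨pathSMul γ.1 δ.1, by simp [pathSMul, γ.2, δ.2]⟩)
    fun _ _ h _ _ k => pathSMul_homotopicRel h k
  one_smul a := by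
    induction a using Quotient.inductionOn
    exact congrArg (Quotient.mk _) (Subtype.ext (ContinuousMap.ext fun s => one_smul G _))
  mul_smul a b c := by
    induction a using Quotient.inductionOn
    induction b using Quotient.inductionOn
    induction c using Quotient.inductionOn
    exact congrArg (Quotient.mk _) (Subtype.ext (ContinuousMap.ext fun s => mul_smul _ _ _))

end UniversalCover

/-! ### Pullback of a group extension -/

namespace GroupExtension

variable {N E G G' : Type*} [Group N] [Group E] [Group G] [Group G']

/-- The fibre product `G' ×_G E`. -/
def pullbackGroup (S : GroupExtension N E G) (f : G' →* G) : Subgroup (G' × E) where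
  carrier := {p | f p.1 = S.rightHom p.2}
  mul_mem' {p q} hp hq := by
    simp only [Set.mem_ofPred_eq] at hp hq ⊢
    simp [hp, hq]
  one_mem' := by simp
  inv_mem' {p} hp := by
    simp only [Set.mem_ofPred_eq] at hp ⊢
    simp [hp]

/-- The pullback `1 → N → G' ×_G E → G' → 1` of an extension `1 → N → E → G → 1` along a
homomorphism `f : G' → G`. -/
def pullback (S : GroupExtension N E G) (f : G' →* G) :
    GroupExtension N (S.pullbackGroup f) G' where
  inl := ((1 : N →* G').prod S.inl).codRestrict _ fun n => by simp [pullbackGroup]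
  rightHom := (MonoidHom.fst G' E).comp (S.pullbackGroup f).subtype
  inl_injective n m h := S.inl_injective (congrArg (fun p => p.1.2) h)
  range_inl_eq_ker_rightHom := by
    ext ⟨⟨x, e⟩, h⟩
    have h' : f x = S.rightHom e := h
    constructor
    · rintro ⟨n, hn⟩
      exact (congrArg (fun p => p.1.1) hn).symm
    · intro hx
      have hx' : x = 1 := hx
      subst hx'
      have : e ∈ S.inl.range := by
        rw [S.range_inl_eq_ker_rightHom, MonoidHom.mem_ker, ← h', map_one]
      obtain ⟨n, rfl⟩ := this
      exact ⟨n, rfl⟩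
  rightHom_surjective x := by
    obtain ⟨e, he⟩ := S.rightHom_surjective (f x)
    exact ⟨⟨(x, e), he.symm⟩, rfl⟩

end GroupExtension

/-! ### Symplectic groups and transvections -/

/-- The group of linear automorphisms of `M` that preserve the bilinear form `B`; for an
alternating nondegenerate `B` this is the symplectic group `Sp(M, B)`. -/
def SpGroup {R M : Type*} [CommRing R] [AddCommGroup M] [Module R M]
    (B : LinearMap.BilinForm R M) : Subgroup (M ≃ₗ[R] M) where
  carrier := {f | ∀ x y, B (f x) (f y) = B x y}
  mul_mem' {f f'} hf hf' x y := by
    rw [LinearEquiv.mul_apply, LinearEquiv.mul_apply, hf, hf']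
  one_mem' _ _ := rfl
  inv_mem' {f} hf x y := by
    have h := hf (f⁻¹ x) (f⁻¹ y)
    have e : ∀ z, f (f⁻¹ z) = z := fun z => f.apply_symm_apply z
    rw [e, e] at h
    exact h.symm

namespace SpGroup

section Transvection

variable {R M : Type*} [CommRing R] [AddCommGroup M] [Module R M]
  {B : LinearMap.BilinForm R M} (hB : B.IsAlt)

/-- The symplectic transvection `T_a(1) : x ↦ x + B(a, x) a`. -/
def transvection (a : M) : SpGroup B :=
  ⟨LinearEquiv.transvection (f := B a) (v := a) (hB a), fun x y => by
    have h : B x a = -B a x := (hB.neg_eq a x).symm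
    simp only [LinearEquiv.transvection.apply, map_add, map_smul, LinearMap.add_apply,
      LinearMap.smul_apply, smul_eq_mul, hB a, h]
    ring⟩

theorem transvection_apply (a x : M) :
    (transvection hB a : M ≃ₗ[R] M) x = x + B a x • a := rfl

theorem transvection_comm {a b : M} (h : B a b = 0) :
    transvection hB a * transvection hB b = transvection hB b * transvection hB a := by
  have h' : B b a = 0 := by rw [← hB.neg_eq a b, h, neg_zero]
  ext x
  simp only [Subgroup.coe_mul, LinearEquiv.mul_apply, transvection_apply, map_add, map_smul, h, h',
    zero_smul, add_zero]
  abel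

theorem transvection_braid {a b : M} (h : B a b * B a b = 1) :
    transvection hB a * transvection hB b * transvection hB a =
      transvection hB b * transvection hB a * transvection hB b := by
  have h' : B b a = -B a b := (hB.neg_eq a b).symm
  ext x
  simp only [Subgroup.coe_mul, LinearEquiv.mul_apply, transvection_apply, map_add, map_smul, h',
    hB a, hB b]
  match_scalars
  · ring
  · linear_combination (-B a x) * h
  · linear_combination (B b x) * h

end Transvection

section BaseChange

variable {H : Type*} [AddCommGroup H]

/-- The inclusion `Sp(H, θ) → Sp(H_ℝ, θ)`, `h ↦ id_ℝ ⊗ h`, where `H_ℝ = ℝ ⊗ H` carries the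
`ℝ`-bilinear extension of `θ`. -/
def toReal (θ : LinearMap.BilinForm ℤ H) : SpGroup θ →* SpGroup (θ.baseChange ℝ) where
  toFun h := ⟨LinearEquiv.baseChange ℤ ℝ H H (h : H ≃ₗ[ℤ] H), fun x y => by
    induction x using TensorProduct.induction_on with
    | zero => simp
    | add x₁ x₂ h₁ h₂ => simp only [map_add, LinearMap.add_apply, h₁, h₂]
    | tmul r x =>
      induction y using TensorProduct.induction_on with
      | zero => simp
      | add y₁ y₂ h₁ h₂ => simp only [map_add, h₁, h₂]
      | tmul s y =>
        have := h.2 x y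
        simp [this]⟩
  map_one' := by
    ext x
    simp
  map_mul' h k := Subtype.ext (LinearEquiv.baseChange_mul _ _ _ _ _)

end BaseChange

/-! #### The topology of the real symplectic group -/

section Topology

variable {V : Type*} [AddCommGroup V] [Module ℝ V] (ω : LinearMap.BilinForm ℝ V)

/-- The inclusion of the symplectic group in the group of units of the endomorphism ring. -/
def toUnits : SpGroup ω →* (Module.End ℝ V)ˣ :=
  (LinearMap.GeneralLinearGroup.generalLinearEquiv ℝ V).symm.toMonoidHom.comp
    (SpGroup ω).subtype

/-- The usual topology of the symplectic group of a finite dimensional real vector space, as a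
subgroup of the units of `End V`, where the finite dimensional algebra `End V` has its canonical
vector space topology. -/
instance instTopologicalSpace : TopologicalSpace (SpGroup ω) :=
  letI : TopologicalSpace (Module.End ℝ V) := moduleTopology ℝ (Module.End ℝ V)
  TopologicalSpace.induced (toUnits ω) inferInstance

instance instIsTopologicalGroup [FiniteDimensional ℝ V] : IsTopologicalGroup (SpGroup ω) := by
  let _ : TopologicalSpace (Module.End ℝ V) := moduleTopology ℝ (Module.End ℝ V)
  have : IsModuleTopology ℝ (Module.End ℝ V) := ⟨rfl⟩
  have : IsTopologicalRing (Module.End ℝ V) := IsModuleTopology.isTopologicalRing ℝ _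
  exact topologicalGroup_induced (toUnits ω)

end Topology

end SpGroup

/-! ### The Lagrangian Grassmannian -/

/-- The Lagrangian Grassmannian: subspaces that equal their own `ω`-orthogonal complement. -/
def Lagrangian {V : Type*} [AddCommGroup V] [Module ℝ V] (ω : LinearMap.BilinForm ℝ V) : Type _ :=
  {L : Submodule ℝ V // ω.orthogonal L = L}

namespace Lagrangian

variable {V : Type*} [AddCommGroup V] [Module ℝ V] {ω : LinearMap.BilinForm ℝ V}

/-- The symplectic group acts on Lagrangian subspaces by taking images. -/
instance instMulAction : MulAction (SpGroup ω) (Lagrangian ω) where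
  smul g L := ⟨L.1.map (g : V ≃ₗ[ℝ] V).toLinearMap, by
    ext x
    obtain ⟨y, rfl⟩ := (g : V ≃ₗ[ℝ] V).surjective x
    have h : y ∈ ω.orthogonal L.1 ↔ y ∈ L.1 := by rw [L.2]
    have hg := g.2
    simp only [LinearMap.BilinForm.mem_orthogonal_iff,
      Submodule.mem_map, forall_exists_index, and_imp, forall_apply_eq_imp_iff₂] at h ⊢
    constructor
    · intro hy
      exact ⟨y, h.1 fun n hn => (hg n y).symm.trans (hy n hn), rfl⟩
    · rintro ⟨z, hz, hzy⟩ n hn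
      have : z = y := (g : V ≃ₗ[ℝ] V).injective hzy
      subst this
      exact (hg n z).trans (h.2 hz n hn)⟩
  one_smul L := Subtype.ext (Submodule.map_id _)
  mul_smul _ _ L := Subtype.ext (Submodule.map_comp _ _ L.1)

/-- The topology of the Lagrangian Grassmannian as a homogeneous space of the symplectic group: a
set is open when all its preimages under the orbit maps `g ↦ g L` are open. (The action is
transitive, so that this is the quotient topology for any single orbit map.) -/
instance instTopologicalSpace : TopologicalSpace (Lagrangian ω) :=
  ⨆ L : Lagrangian ω, TopologicalSpace.coinduced (fun g : SpGroup ω => g • L) inferInstance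

theorem isOpen_iff {U : Set (Lagrangian ω)} :
    IsOpen U ↔ ∀ L : Lagrangian ω, IsOpen {g : SpGroup ω | g • L ∈ U} := by
  simp only [isOpen_iSup_iff, isOpen_coinduced]
  rfl

instance instContinuousSMul [FiniteDimensional ℝ V] :
    ContinuousSMul (SpGroup ω) (Lagrangian ω) where
  continuous_smul := by
    rw [continuous_iff_continuousAt]
    rintro ⟨g, L⟩ 
    rw [ContinuousAt, tendsto_nhds]
    intro U hU hgL
    have h₁ : IsOpen {p : SpGroup ω × SpGroup ω | (p.1 * p.2) • L ∈ U} :=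
      (isOpen_iff.1 hU L).preimage continuous_mul
    obtain ⟨A, B, hA, hB, hgA, hB1, hAB⟩ := isOpen_prod_iff.1 h₁ g 1 (by simpa using hgL)
    have hBL : IsOpen ((fun b : SpGroup ω => b • L) '' B) := by
      rw [isOpen_iff]
      intro L'
      rw [isOpen_iff_forall_mem_open]
      rintro k ⟨b, hb, hbk⟩
      refine ⟨(fun x => x * (k⁻¹ * b)) ⁻¹' B, ?_, hB.preimage (by fun_prop), by simpa using hb⟩
      intro x hx
      refine ⟨_, hx, ?_⟩
      have hbk' : b • L = k • L' := hbk
      show (x * (k⁻¹ * b)) • L = x • L'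
      rw [mul_smul, mul_smul, hbk', inv_smul_smul]
    refine Filter.mem_of_superset ((hA.prod hBL).mem_nhds ⟨hgA, ⟨1, hB1, one_smul _ L⟩⟩) ?_
    rintro ⟨x, _⟩ ⟨hx, ⟨b, hb, rfl⟩⟩
    have := hAB (Set.mk_mem_prod hx hb)
    simpa [mul_smul] using this

end Lagrangian

/-! ### The universal cover of the symplectic group -/

/-- The universal cover of the real symplectic group `Sp(V, ω)`. -/
abbrev SpTilde {V : Type*} [AddCommGroup V] [Module ℝ V] (ω : LinearMap.BilinForm ℝ V) : Type _ :=
  UniversalCover (SpGroup ω) 1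

/-- The universal cover of the Lagrangian Grassmannian of `(V, ω)`, with base point `L₀`. -/
abbrev LagrangianTilde {V : Type*} [AddCommGroup V] [Module ℝ V] {ω : LinearMap.BilinForm ℝ V}
    (L₀ : Lagrangian ω) : Type _ :=
  UniversalCover (Lagrangian ω) L₀

/-- `q` is a lift of `t ∈ Sp(V, ω)` to the universal cover that acts with fixed points on the
universal cover of the Lagrangian Grassmannian. -/
def IsFixedPointLift {V : Type*} [AddCommGroup V] [Module ℝ V] [FiniteDimensional ℝ V]
    {ω : LinearMap.BilinForm ℝ V} (L₀ : Lagrangian ω) (t : SpGroup ω) (q : SpTilde ω) : Prop :=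
  UniversalCover.projHom (SpGroup ω) q = t ∧ ∃ x : LagrangianTilde L₀, q • x = x

/-- `S̃p(H, θ)`: the preimage in `S̃p(H_ℝ, θ)` of the integral symplectic group `Sp(H, θ)`. -/
def SpTildeInt {H : Type*} [AddCommGroup H] [Module.Finite ℤ H] (θ : LinearMap.BilinForm ℤ H) :
    Subgroup (SpTilde (θ.baseChange ℝ)) :=
  (SpGroup.toReal θ).range.comap (UniversalCover.projHom (SpGroup (θ.baseChange ℝ)))

/-! ### The braid group and its symplectic representation -/

/-- The defining relations of the Artin group of type `A_m` on generators `t_0, …, t_{m-1}`: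
`t_i t_j = t_j t_i` for `|i - j| ≥ 2` and `t_i t_{i+1} t_i = t_{i+1} t_i t_{i+1}`. -/
def braidRels (m : ℕ) : Set (FreeGroup (Fin m)) :=
  {r | ∃ i j : Fin m, (i : ℕ) + 2 ≤ j ∧
      r = (FreeGroup.of i * FreeGroup.of j) * (FreeGroup.of j * FreeGroup.of i)⁻¹} ∪
  {r | ∃ i j : Fin m, (i : ℕ) + 1 = j ∧
      r = (FreeGroup.of i * FreeGroup.of j * FreeGroup.of i) *
        (FreeGroup.of j * FreeGroup.of i * FreeGroup.of j)⁻¹}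

/-- The Artin braid group of type `A_{n-1}`, that is, the braid group on `n` strands (`n ≥ 1`),
with standard generators `t_0, …, t_{n-2}`. -/
abbrev BraidGroup (n : ℕ) : Type := PresentedGroup (braidRels (n - 1))

/-- The standard generators of the braid group. -/
def BraidGroup.t {n : ℕ} (i : Fin (n - 1)) : BraidGroup n := PresentedGroup.of i

/-- A sequence of elements of `H` with the intersection pattern of a chain of simple closed curves:
consecutive elements have intersection number `±1`, all others have intersection number `0`. -/
structure IsCurveChain {H : Type*} [AddCommGroup H] (θ : LinearMap.BilinForm ℤ H) {m : ℕ}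
    (a : Fin m → H) : Prop where
  consecutive : ∀ i j : Fin m, (i : ℕ) + 1 = j → |θ (a i) (a j)| = 1
  disjoint : ∀ i j : Fin m, (i : ℕ) + 2 ≤ j → θ (a i) (a j) = 0

/-- The homomorphism `σ` from the braid group to `Sp(H, θ)` that sends the generator `t_i` to the
transvection in the class `a_i` of the `i`-th curve of a chain (the action on homology of the
Dehn twist about that curve). -/
def braidToSp {H : Type*} [AddCommGroup H] {θ : LinearMap.BilinForm ℤ H} (hθ : θ.IsAlt) {n : ℕ}
    {a : Fin (n - 1) → H} (ha : IsCurveChain θ a) : BraidGroup n →* SpGroup θ :=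
  PresentedGroup.toGroup (f := fun i => SpGroup.transvection hθ (a i)) (by
    rintro r (⟨i, j, hij, rfl⟩ | ⟨i, j, hij, rfl⟩)
    · simp only [map_mul, map_inv, FreeGroup.lift_apply_of]
      rw [SpGroup.transvection_comm hθ (ha.disjoint i j hij), mul_inv_cancel]
    · simp only [map_mul, map_inv, FreeGroup.lift_apply_of]
      rw [SpGroup.transvection_braid hθ (abs_mul_abs_self (θ (a i) (a j)) ▸ by
        rw [ha.consecutive i j hij, one_mul]), mul_inv_cancel])

theorem braidToSp_t {H : Type*} [AddCommGroup H] {θ : LinearMap.BilinForm ℤ H} (hθ : θ.IsAlt)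
    {n : ℕ} {a : Fin (n - 1) → H} (ha : IsCurveChain θ a) (i : Fin (n - 1)) :
    braidToSp hθ ha (BraidGroup.t i) = SpGroup.transvection hθ (a i) :=
  PresentedGroup.toGroup.of _

end

/-! A transvection `T_a` lies on the path `x ↦ x + s θ(a, x) a`, `0 ≤ s ≤ 1`, and the class of this
path is a canonical lift `shearLift` to the universal cover. These lifts are natural: conjugation by
an element over `g` turns the lift for `a` into the lift for `g a` (`conj_shearLift`). If `θ(a, b) =
±1`, then `T_a T_b` maps `a` to `∓b`, and a lift does not see the sign of its vector. So naturality
alone gives the braid relation (`shearLift_braid`). If `θ(a, b) = 0`, the two paths commute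
pointwise. Hence the generators `t_i` can be sent to the canonical lifts, and the resulting
homomorphism splits the pulled back extension.

Two facts about `π` remain. The first is that its kernel is infinite cyclic. It is generated by a
full turn in a hyperbolic plane (`exists_eq_rotClass`): a loop is deformed, by multiplication with
contractible loops of elementary maps, until up to a rotation it fixes one more hyperbolic pair of a
symplectic basis. The generator has infinite order because of the squared determinant phase on the
Lagrangian Grassmannian, along which `m` turns wind `2m` times around the origin. The same winding
number shows that the kernel acts freely on the cover of the Grassmannian
(`eq_one_of_mem_ker_of_smul`).

The second is the characterisation by fixed points. A Lagrangian subspace fixed by `T_a` contains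
`a`, and over such a subspace the canonical lift fixes every point. So another lift with a fixed
point differs from the canonical one by a kernel element with a fixed point, which is trivial
(`eq_shearLift`). -/

noncomputable section

/-! ### Classes of paths in topological groups -/

namespace UniversalCover

variable {X : Type*} [TopologicalSpace X] {x₀ : X}

/-- The point of the universal cover represented by a path. -/
def mk (γ : C(I, X)) (h : γ 0 = x₀) : UniversalCover X x₀ := Quotient.mk _ ⟨γ, h⟩

theorem ind_mk {P : UniversalCover X x₀ → Prop} (h : ∀ γ h, P (mk γ h)) (x) : P x := by
  induction x using Quotient.inductionOn with
  | h γ => exact h γ.1 γ.2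

theorem mk_eq_of_homotopy {γ δ : C(I, X)} {hγ : γ 0 = x₀} {hδ : δ 0 = x₀} (F : I → I → X)
    (hF : Continuous fun p : I × I => F p.1 p.2) (h₀ : ∀ s, F 0 s = γ s) (h₁ : ∀ s, F 1 s = δ s)
    (hl : ∀ t, F t 0 = x₀) (hr : ∀ t, F t 1 = γ 1) : mk γ hγ = mk δ hδ :=
  Quotient.sound ⟨{
    toFun := fun p => F p.1 p.2
    continuous_toFun := hF
    map_zero_left := h₀
    map_one_left := h₁
    prop' := by
      rintro t x (rfl | rfl)
      · simp [hl, hγ]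
      · simp [hr] }⟩

theorem homotopicRel_of_mk_eq {γ δ : C(I, X)} {hγ : γ 0 = x₀} {hδ : δ 0 = x₀}
    (h : mk γ hγ = mk δ hδ) : γ.HomotopicRel δ {0, 1} :=
  Quotient.exact h

theorem proj_mk (γ : C(I, X)) (h : γ 0 = x₀) : proj (mk γ h) = γ 1 := rfl

variable {G : Type*} [Group G] [TopologicalSpace G] [IsTopologicalGroup G]

theorem projHom_mk (γ : C(I, G)) (h : γ 0 = 1) : projHom G (mk γ h) = γ 1 := rfl

theorem mk_mul_mk (γ δ : C(I, G)) (h : γ 0 = 1) (k : δ 0 = 1) :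
    mk γ h * mk δ k = mk (γ * δ) (by simp [h, k]) := rfl

theorem mk_inv (γ : C(I, G)) (h : γ 0 = 1) : (mk γ h)⁻¹ = mk γ⁻¹ (by simp [h]) := rfl

theorem mk_smul_mk [MulAction G X] [ContinuousSMul G X] (γ : C(I, G)) (δ : C(I, X)) (h : γ 0 = 1)
    (k : δ 0 = x₀) : mk γ h • mk δ k = mk (pathSMul γ δ) (by simp [pathSMul, h, k]) := rfl

theorem mk_eq_one_of_homotopy {γ : C(I, G)} {hγ : γ 0 = 1} (F : I → I → G)
    (hF : Continuous fun p : I × I => F p.1 p.2) (h₀ : ∀ s, F 0 s = 1) (h₁ : ∀ s, F 1 s = γ s)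
    (hl : ∀ t, F t 0 = 1) (hr : ∀ t, F t 1 = 1) : mk γ hγ = 1 :=
  (mk_eq_of_homotopy (γ := 1) (hγ := rfl) F hF h₀ h₁ hl hr).symm

/-- The kernel of the projection of the universal cover of a topological group is central. -/
theorem ker_projHom_le_center :
    (projHom G).ker ≤ Subgroup.center (UniversalCover G (1 : G)) := by
  intro z hz
  rw [Subgroup.mem_center_iff]
  intro x
  induction x using ind_mk with | h γ hγ => ?_
  induction z using ind_mk with | h l hl => ?_
  have hl1 : l 1 = 1 := hz
  rw [← mul_inv_eq_iff_eq_mul, mk_inv, mk_mul_mk, mk_mul_mk]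
  symm
  -- The conjugating path is stretched from the constant path `1` to `γ`; the right end stays at `1`
  -- because `l` is a loop.
  refine mk_eq_of_homotopy (fun t s => γ (t * s) * l s * (γ (t * s))⁻¹) (by fun_prop) ?_ ?_ ?_ ?_
  · intro s; simp [hγ]
  · intro s; simp
  · intro t; simp [hγ, hl]
  · intro t; simp [hl1]

/-- Conjugating a loop by an element that can be joined to the identity does not change its
class. -/
theorem mk_conj_of_joined {g : G} (hg : Joined 1 g) {γ δ : C(I, G)} (hγ : γ 0 = 1) (hγ' : γ 1 = 1)
    (hδ : δ 0 = 1) (h : ∀ s, δ s = g * γ s * g⁻¹) : mk γ hγ = mk δ hδ := by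
  obtain ⟨p⟩ := hg
  refine mk_eq_of_homotopy (fun t s => p t * γ s * (p t)⁻¹) (by fun_prop) ?_ ?_ ?_ ?_
  · intro s; simp
  · intro s; simp [h]
  · intro t; simp [hγ]
  · intro t; simp [hγ']

theorem projHom_surjective (h : ∀ g : G, Joined 1 g) : Function.Surjective (projHom G) := by
  intro g
  obtain ⟨p⟩ := h g
  exact ⟨mk p.toContinuousMap p.source, p.target⟩

end UniversalCover

theorem Joined.mul_of_one {G : Type*} [Group G] [TopologicalSpace G] [IsTopologicalGroup G]
    {g h : G} (hg : Joined 1 g) (hh : Joined 1 h) : Joined 1 (g * h) := by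
  obtain ⟨p⟩ := hg
  obtain ⟨q⟩ := hh
  exact ⟨⟨⟨fun t => p t * q t, by fun_prop⟩, by simp, by simp⟩⟩

theorem Joined.inv_of_one {G : Type*} [Group G] [TopologicalSpace G] [IsTopologicalGroup G]
    {g : G} (hg : Joined 1 g) : Joined 1 g⁻¹ := by
  obtain ⟨p⟩ := hg
  exact ⟨⟨⟨fun t => (p t)⁻¹, by fun_prop⟩, by simp, by simp⟩⟩

theorem joined_one_of_continuous {G : Type*} [Group G] [TopologicalSpace G] (φ : ℝ → G)
    (hφ : Continuous φ) (h₀ : φ 0 = 1) : Joined 1 (φ 1) :=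
  ⟨⟨⟨fun t => φ t, by fun_prop⟩, by simpa using h₀, by simp⟩⟩

end

/-! ### Symplectic bases and elementary symplectic maps -/

noncomputable section

/-- Alternating forms with trivial radical. -/
class IsSymplecticForm {V : Type*} [AddCommGroup V] [Module ℝ V] (ω : LinearMap.BilinForm ℝ V) :
    Prop where
  isAlt : ω.IsAlt
  separating : ∀ x, (∀ y, ω x y = 0) → x = 0

/-- A symplectic basis `e₁, …, eₙ, f₁, …, fₙ`. -/
structure SymplecticBasis {V : Type*} [AddCommGroup V] [Module ℝ V] (ω : LinearMap.BilinForm ℝ V)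
    (n : ℕ) where
  e : Fin n → V
  f : Fin n → V
  form_e_e : ∀ i j, ω (e i) (e j) = 0
  form_f_f : ∀ i j, ω (f i) (f j) = 0
  form_e_f : ∀ i j, ω (e i) (f j) = if i = j then 1 else 0
  expand : ∀ x, x = ∑ i, (ω x (f i) • e i + ω (e i) x • f i)

variable {V : Type*} [AddCommGroup V] [Module ℝ V] {ω : LinearMap.BilinForm ℝ V}

section Form

theorem form_smul_right_eq_zero {a z : V} (h : ω a z = 0) (t : ℝ) : ω a (t • z) = 0 := by
  simp [h]

theorem ne_zero_of_form_eq_one {e f : V} (h : ω e f = 1) : e ≠ 0 := by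
  rintro rfl
  simp at h


variable [IsSymplecticForm ω]

theorem form_self (x : V) : ω x x = 0 := IsSymplecticForm.isAlt x

theorem form_swap (x y : V) : ω x y = -ω y x := (IsSymplecticForm.isAlt.neg_eq y x).symm

end Form

namespace SpGroup

theorem smul_def (g : SpGroup ω) (x : V) : g • x = (g : V ≃ₗ[ℝ] V) x := rfl

theorem form_smul_smul (g : SpGroup ω) (x y : V) : ω (g • x) (g • y) = ω x y := g.2 x y

theorem ext_smul {g h : SpGroup ω} (H : ∀ x : V, g • x = h • x) : g = h :=
  Subtype.ext (LinearEquiv.ext H)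

theorem smul_form_left (g : SpGroup ω) (x y : V) : ω (g⁻¹ • x) y = ω x (g • y) := by
  rw [← form_smul_smul g, smul_inv_smul]

variable [FiniteDimensional ℝ V] [IsSymplecticForm ω]

/-- A form-preserving endomorphism as an element of the symplectic group. -/
def ofEnd (φ : V →ₗ[ℝ] V) (h : ∀ x y, ω (φ x) (φ y) = ω x y) : SpGroup ω :=
  ⟨LinearEquiv.ofInjectiveEndo φ (by
    rw [← LinearMap.ker_eq_bot, LinearMap.ker_eq_bot']
    intro x hx
    refine IsSymplecticForm.separating (ω := ω) x fun y => ?_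
    rw [← h, hx, map_zero, LinearMap.zero_apply]), h⟩

theorem ofEnd_smul (φ : V →ₗ[ℝ] V) (h : ∀ x y, ω (φ x) (φ y) = ω x y) (x : V) :
    ofEnd φ h • x = φ x := rfl

variable (ω) in
/-- The transvection `x ↦ x + c ω(a, x) a`. -/
def shear (a : V) (c : ℝ) : SpGroup ω :=
  ofEnd (LinearMap.id + c • (ω a).smulRight a) fun x y => by
    simp [form_self, form_swap (ω := ω) x a]
    ring

theorem shear_smul (a : V) (c : ℝ) (x : V) : shear ω a c • x = x + (c * ω a x) • a := by
  simp [shear, ofEnd_smul, mul_smul]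

theorem shear_zero (a : V) : shear ω a 0 = 1 :=
  ext_smul fun x => by simp [shear_smul]

variable (ω) in
/-- The Eichler transformation `x ↦ x + ω(a, x) z + ω(z, x) a`, where `ω(a, z) = 0`. -/
def eichler (a z : V) (h : ω a z = 0) : SpGroup ω :=
  ofEnd (LinearMap.id + (ω a).smulRight z + (ω z).smulRight a) fun x y => by
    simp [form_self, form_swap (ω := ω) x a, form_swap (ω := ω) x z, h, form_swap (ω := ω) z a]
    ring

theorem eichler_smul (a z : V) (h : ω a z = 0) (x : V) :
    eichler ω a z h • x = x + ω a x • z + ω z x • a := by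
  simp [eichler, ofEnd_smul]

variable (ω) in
/-- The map that acts on the hyperbolic plane spanned by `e` and `f` by the matrix
`!![x, x'; y, y']`, and trivially on its orthogonal complement. -/
def planeMap (e f : V) (h : ω e f = 1) (x y x' y' : ℝ) (hd : x * y' - y * x' = 1) : SpGroup ω :=
  ofEnd (LinearMap.id + (((x - 1) • ω.flip f + x' • ω e).smulRight e) +
    ((y • ω.flip f + (y' - 1) • ω e).smulRight f)) fun u v => by
    simp [form_self, form_swap (ω := ω) f e, h, form_swap (ω := ω) u e, form_swap (ω := ω) f v]
    linear_combination (ω e v * ω u f - ω e u * ω v f) * hd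

theorem planeMap_smul (e f : V) (h : ω e f = 1) (x y x' y' : ℝ) (hd : x * y' - y * x' = 1) (v : V) :
    planeMap ω e f h x y x' y' hd • v =
      v + ((x - 1) * ω v f + x' * ω e v) • e + (y * ω v f + (y' - 1) * ω e v) • f := by
  simp [planeMap, ofEnd_smul]

end SpGroup

namespace Lagrangian

theorem form_eq_zero (L : Lagrangian ω) {x y : V} (hx : x ∈ L.1) (hy : y ∈ L.1) : ω x y = 0 := by
  rw [← L.2] at hy
  exact hy x hx

theorem mem_of_form_eq_zero (L : Lagrangian ω) {y : V} (h : ∀ x ∈ L.1, ω x y = 0) : y ∈ L.1 := by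
  rw [← L.2]
  exact h

theorem smul_val (g : SpGroup ω) (L : Lagrangian ω) :
    (g • L).1 = L.1.map (g : V ≃ₗ[ℝ] V).toLinearMap := rfl

theorem smul_mem_smul {g : SpGroup ω} {L : Lagrangian ω} {x : V} (h : x ∈ L.1) :
    g • x ∈ (g • L).1 := Submodule.mem_map_of_mem h

variable [FiniteDimensional ℝ V] [IsSymplecticForm ω]

/-- A maximal isotropic subspace is Lagrangian: since the form is alternating, adjoining a vector of
the orthogonal complement keeps the subspace isotropic. -/
theorem nonempty : Nonempty (Lagrangian ω) := by
  obtain ⟨L, hL⟩ := exists_maximal_of_wellFoundedGT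
    (fun L : Submodule ℝ V => L ≤ ω.orthogonal L) ⟨⊥, bot_le⟩
  refine ⟨⟨L, le_antisymm (fun x hx => ?_) hL.prop⟩⟩
  have h : L ⊔ ℝ ∙ x ≤ ω.orthogonal (L ⊔ ℝ ∙ x) := by
    intro y hy z hz
    obtain ⟨a, ha, c, hc, rfl⟩ := Submodule.mem_sup.1 hy
    obtain ⟨b, hb, d, hd, rfl⟩ := Submodule.mem_sup.1 hz
    obtain ⟨c, rfl⟩ := Submodule.mem_span_singleton.1 hc
    obtain ⟨d, rfl⟩ := Submodule.mem_span_singleton.1 hd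
    have h₁ : ω b a = 0 := hL.prop ha b hb
    have h₂ : ω b x = 0 := hx b hb
    have h₃ : ω x a = 0 := by rw [form_swap, hx a ha, neg_zero]
    simp [h₁, h₂, h₃, form_self]
  exact hL.le_of_ge h le_sup_left (Submodule.mem_sup_right (Submodule.mem_span_singleton_self x))

theorem two_mul_finrank (L : Lagrangian ω) :
    2 * Module.finrank ℝ L.1 = Module.finrank ℝ V := by
  have h := LinearMap.BilinForm.finrank_orthogonal (B := ω)
    ⟨fun x hx => IsSymplecticForm.separating (ω := ω) x hx,
      fun x hx => IsSymplecticForm.separating (ω := ω) x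
        fun y => by rw [form_swap, hx, neg_zero]⟩ L.1
  rw [L.2] at h
  have := Submodule.finrank_le L.1
  omega

/-- Every Lagrangian subspace is spanned by the first half of a symplectic basis. -/
theorem exists_symplecticBasis {n : ℕ} (hn : Module.finrank ℝ V = 2 * n) (L : Lagrangian ω) :
    ∃ B : SymplecticBasis ω n, Submodule.span ℝ (Set.range B.e) = L.1 := by
  have hL : Module.finrank ℝ L.1 = n := by have := L.two_mul_finrank; omega
  let b := Module.finBasisOfFinrankEq ℝ L.1 hL
  let e : Fin n → V := fun i => b i
  have he : ∀ i, e i ∈ L.1 := fun i => (b i).2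
  have hsurj : Function.Surjective ω := by
    refine (LinearMap.injective_iff_surjective_of_finrank_eq_finrank
      (Subspace.dual_finrank_eq).symm).1 ?_
    rw [← LinearMap.ker_eq_bot, LinearMap.ker_eq_bot']
    exact fun x hx => IsSymplecticForm.separating (ω := ω) x fun y => by rw [hx]; rfl
  have hf : ∀ j, ∃ f : V, ∀ i, ω (e i) f = if i = j then 1 else 0 := by
    intro j
    obtain ⟨ψ, hψ⟩ := LinearMap.exists_extend (b.coord j)
    obtain ⟨y, hy⟩ := hsurj ψ
    refine ⟨-y, fun i => ?_⟩
    have : ψ (b i : V) = b.coord j (b i) := by rw [← hψ]; rfl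
    rw [map_neg, ← form_swap, hy, this]
    simp [Finsupp.single_apply]
  choose f' hf' using hf
  -- The vectors `f'` are dual to `e` but need not be isotropic. Each of the two corrections removes
  -- half of `ω (f' i) (f' j)`, and pairings with `e` do not change.
  let f : Fin n → V := fun j => f' j - (1 / 2 : ℝ) • ∑ k, ω (f' j) (f' k) • e k
  have hee : ∀ i j, ω (e i) (e j) = 0 := fun i j => L.form_eq_zero (he i) (he j)
  have hef : ∀ i j, ω (e i) (f j) = if i = j then 1 else 0 := by
    intro i j
    simp [f, hee, hf']
  have hspan : Submodule.span ℝ (Set.range e) = L.1 := by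
    have : Set.range e = L.1.subtype '' Set.range b := by
      rw [← Set.range_comp]; rfl
    rw [this, ← Submodule.map_span, b.span_eq, Submodule.map_top, Submodule.range_subtype]
  have hff : ∀ i j, ω (f i) (f j) = 0 := by
    intro i j
    have h' : ∀ i j, ω (f' i) (e j) = - if j = i then 1 else 0 := fun i j => by
      rw [form_swap, hf']
    simp [f, hee, hf', h', form_swap (ω := ω) (f' j) (f' i)]
    ring
  refine ⟨⟨e, f, hee, hff, hef, fun x => ?_⟩, hspan⟩
  -- The difference `x - y` is orthogonal to all `e j`, so it lies in `L`, and its coefficients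
  -- there are read off by pairing with the `f j`, which gives zero.
  set y := ∑ i, (ω x (f i) • e i + ω (e i) x • f i) with hy
  have hy' : ∀ j, ω (e j) (x - y) = 0 := by
    intro j
    simp [hy, hee, hef]
  have hyf : ∀ j, ω (f j) (x - y) = 0 := by
    intro j
    have h' : ∀ i, ω (f j) (e i) = - if i = j then 1 else 0 := fun i => by
      rw [form_swap, hef]
    simp [hy, hff, h', form_swap (ω := ω) (f j) x]
  have hmem : x - y ∈ L.1 := by
    refine L.mem_of_form_eq_zero fun z hz => ?_
    rw [← hspan] at hz
    induction hz using Submodule.span_induction with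
    | mem z hz => obtain ⟨j, rfl⟩ := hz; exact hy' j
    | zero => simp
    | add a b _ _ ha hb => simp [ha, hb]
    | smul c a _ ha => simp [ha]
  rw [← hspan, Submodule.mem_span_range_iff_exists_fun] at hmem
  obtain ⟨c, hc⟩ := hmem
  have : ∀ j, c j = 0 := by
    intro j
    have h' : ∀ i, ω (f j) (e i) = - if i = j then 1 else 0 := fun i => by
      rw [form_swap, hef]
    have := hyf j
    rw [← hc] at this
    simpa [h'] using this
  rw [← sub_eq_zero, ← hc]
  simp [this]

end Lagrangian

end

/-! ### Continuity criteria for the symplectic group -/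

noncomputable section

variable {V : Type*} [AddCommGroup V] [Module ℝ V] {ω : LinearMap.BilinForm ℝ V}
theorem Continuous.form [FiniteDimensional ℝ V] [TopologicalSpace V] [IsModuleTopology ℝ V]
    {T : Type*} [TopologicalSpace T] {a b : T → V} (ha : Continuous a)
    (hb : Continuous b) : Continuous fun t => ω (a t) (b t) := by
  have := IsModuleTopology.toContinuousAdd ℝ V
  exact (IsModuleTopology.continuous_bilinear_of_finite_left (R := ℝ) ω).comp (ha.prodMk hb)

variable [FiniteDimensional ℝ V] [IsSymplecticForm ω]

variable (ω) in
theorem exists_symplecticBasis : ∃ n, Nonempty (SymplecticBasis ω n) := by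
  obtain ⟨L⟩ := Lagrangian.nonempty (ω := ω)
  obtain ⟨B, -⟩ := L.exists_symplecticBasis L.two_mul_finrank.symm
  exact ⟨_, ⟨B⟩⟩

variable [TopologicalSpace V] [IsModuleTopology ℝ V]

/-- The coordinates in a symplectic basis are themselves values of the form. -/
theorem continuous_of_form {T : Type*} [TopologicalSpace T] {a : T → V}
    (ha : ∀ y, Continuous fun t => ω (a t) y) : Continuous a := by
  have := IsModuleTopology.toContinuousAdd ℝ V
  obtain ⟨n, ⟨B⟩⟩ := exists_symplecticBasis ω
  have h : ∀ y, Continuous fun t => ω y (a t) := fun y => by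
    simp only [form_swap (ω := ω) y]
    exact (ha y).neg
  have : a = fun t => ∑ i, (ω (a t) (B.f i) • B.e i + ω (B.e i) (a t) • B.f i) :=
    funext fun t => B.expand _
  rw [this]
  exact continuous_finsetSum _ fun i _ =>
    ((ha _).smul continuous_const).add ((h _).smul continuous_const)

theorem continuous_end_of_apply {T : Type*} [TopologicalSpace T]
    [TopologicalSpace (Module.End ℝ V)] [IsModuleTopology ℝ (Module.End ℝ V)]
    {φ : T → Module.End ℝ V} (h : ∀ y, Continuous fun t => φ t y) : Continuous φ := by
  have := IsModuleTopology.toContinuousAdd ℝ V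
  have := IsModuleTopology.toContinuousAdd ℝ (Module.End ℝ V)
  let b := Module.finBasis ℝ V
  let c := (b.constr ℝ : (_ → V) ≃ₗ[ℝ] (V →ₗ[ℝ] V))
  have hc : Continuous c := IsModuleTopology.continuous_of_linearMap c.toLinearMap
  have : φ = fun t => c fun i => φ t (b i) := by
    funext t
    exact b.ext fun i => (b.constr_basis ℝ (fun i => φ t (b i)) i).symm
  rw [this]
  exact hc.comp (continuous_pi fun i => h _)

namespace SpGroup

instance instContinuousSMulVector : ContinuousSMul (SpGroup ω) V := by
  let _ : TopologicalSpace (Module.End ℝ V) := moduleTopology ℝ (Module.End ℝ V)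
  have : IsModuleTopology ℝ (Module.End ℝ V) := ⟨rfl⟩
  have := IsModuleTopology.toContinuousAdd ℝ V
  have := IsModuleTopology.toContinuousAdd ℝ (Module.End ℝ V)
  have h : Continuous fun g : SpGroup ω => (toUnits ω g : Module.End ℝ V) :=
    Units.continuous_val.comp continuous_induced_dom
  exact ⟨(IsModuleTopology.continuous_bilinear_of_finite_left (R := ℝ)
    (LinearMap.id : Module.End ℝ V →ₗ[ℝ] V →ₗ[ℝ] V)).comp
      ((h.comp continuous_fst).prodMk continuous_snd)⟩

/-- A map to the symplectic group is continuous if it is pointwise continuous. -/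
theorem continuous_of_smul {T : Type*} [TopologicalSpace T] {φ : T → SpGroup ω}
    (h : ∀ y : V, Continuous fun t => φ t • y) : Continuous φ := by
  let _ : TopologicalSpace (Module.End ℝ V) := moduleTopology ℝ (Module.End ℝ V)
  have : IsModuleTopology ℝ (Module.End ℝ V) := ⟨rfl⟩
  refine continuous_induced_rng.2 (Units.continuous_iff.2 ⟨?_, ?_⟩)
  · exact continuous_end_of_apply h
  -- The topology of units also demands a continuous inverse. The adjoint of `(φ t)⁻¹` is `φ t`, so
  -- the pairings of the inverse are controlled by `φ` itself.
  · refine continuous_end_of_apply fun y => ?_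
    refine continuous_of_form (ω := ω) fun x => ?_
    have : ∀ t, ω ((φ t)⁻¹ • y) x = ω y (φ t • x) := fun t => smul_form_left _ _ _
    exact (continuous_const.form (h x)).congr fun t => (this t).symm

variable {T : Type*} [TopologicalSpace T]

theorem continuous_shear {a : T → V} {c : T → ℝ} (ha : Continuous a) (hc : Continuous c) :
    Continuous fun t => shear ω (a t) (c t) := by
  have := IsModuleTopology.toContinuousAdd ℝ V
  refine continuous_of_smul fun y => ?_
  simp only [shear_smul]
  exact continuous_const.add ((hc.mul (ha.form continuous_const)).smul ha)

theorem continuous_eichler {a z : T → V} (h : ∀ t, ω (a t) (z t) = 0) (ha : Continuous a)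
    (hz : Continuous z) : Continuous fun t => eichler ω (a t) (z t) (h t) := by
  have := IsModuleTopology.toContinuousAdd ℝ V
  refine continuous_of_smul fun y => ?_
  simp only [eichler_smul]
  exact (continuous_const.add ((ha.form continuous_const).smul hz)).add
    ((hz.form continuous_const).smul ha)

theorem continuous_planeMap (e f : V) (h : ω e f = 1) {x y x' y' : T → ℝ}
    (hd : ∀ t, x t * y' t - y t * x' t = 1) (hx : Continuous x) (hy : Continuous y)
    (hx' : Continuous x') (hy' : Continuous y') :
    Continuous fun t => planeMap ω e f h (x t) (y t) (x' t) (y' t) (hd t) := by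
  have := IsModuleTopology.toContinuousAdd ℝ V
  refine continuous_of_smul fun v => ?_
  simp only [planeMap_smul]
  fun_prop

end SpGroup

end

/-! ### Transitivity on hyperbolic pairs and path connectedness -/

noncomputable section

variable {V : Type*} [AddCommGroup V] [Module ℝ V] {ω : LinearMap.BilinForm ℝ V}

namespace SymplecticBasis

variable {n : ℕ} (B : SymplecticBasis ω n) (k : ℕ)

/-- The vectors orthogonal to the first `k` hyperbolic pairs of a symplectic basis. -/
def tail : Submodule ℝ V where
  carrier := {v | ∀ i : Fin n, (i : ℕ) < k → ω (B.e i) v = 0 ∧ ω (B.f i) v = 0}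
  add_mem' ha hb i hi := by simp [(ha i hi).1, (ha i hi).2, (hb i hi).1, (hb i hi).2]
  zero_mem' i _ := by simp
  smul_mem' c a ha i hi := by simp [(ha i hi).1, (ha i hi).2]

/-- The symplectic maps that fix the first `k` hyperbolic pairs of a symplectic basis. -/
def fixer : Subgroup (SpGroup ω) where
  carrier := {g | ∀ i : Fin n, (i : ℕ) < k → g • B.e i = B.e i ∧ g • B.f i = B.f i}
  mul_mem' ha hb i hi := by
    simp [mul_smul, (ha i hi).1, (ha i hi).2, (hb i hi).1, (hb i hi).2]
  one_mem' i _ := by simp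
  inv_mem' ha i hi := by simp [inv_smul_eq_iff, (ha i hi).1, (ha i hi).2]

variable {k}

theorem form_e_f_self (i : Fin n) : ω (B.e i) (B.f i) = 1 := by
  simp [B.form_e_f]

variable {B}

theorem smul_mem_tail {g : SpGroup ω} (hg : g ∈ B.fixer k) {v : V} (hv : v ∈ B.tail k) :
    g • v ∈ B.tail k := by
  intro i hi
  have h₁ := SpGroup.form_smul_smul g (B.e i) v
  have h₂ := SpGroup.form_smul_smul g (B.f i) v
  rw [(hg i hi).1, (hv i hi).1] at h₁
  rw [(hg i hi).2, (hv i hi).2] at h₂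
  exact ⟨h₁, h₂⟩

theorem fixer_zero (g : SpGroup ω) : g ∈ B.fixer 0 := fun _ h => absurd h (Nat.not_lt_zero _)

theorem tail_zero (v : V) : v ∈ B.tail 0 := fun _ h => absurd h (Nat.not_lt_zero _)

theorem mem_fixer_succ {i : Fin n} {g : SpGroup ω} :
    g ∈ B.fixer (i + 1) ↔ g ∈ B.fixer i ∧ g • B.e i = B.e i ∧ g • B.f i = B.f i := by
  refine ⟨fun h => ⟨fun j hj => h j (by omega), h i (by omega)⟩, fun h j hj => ?_⟩
  rcases Nat.lt_succ_iff_lt_or_eq.1 hj with hj | hj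
  · exact h.1 j hj
  · rw [Fin.ext hj]
    exact h.2

theorem eq_one_of_mem_fixer {g : SpGroup ω} (hg : g ∈ B.fixer n) : g = 1 := by
  refine SpGroup.ext_smul fun x => ?_
  conv_lhs => rw [B.expand x]
  conv_rhs => rw [one_smul, B.expand x]
  rw [SpGroup.smul_def, map_sum]
  refine Finset.sum_congr rfl fun i _ => ?_
  rw [map_add, map_smul, map_smul, ← SpGroup.smul_def, ← SpGroup.smul_def, (hg i i.2).1,
    (hg i i.2).2]

theorem f_mem_tail {i : Fin n} (h : k ≤ i) : B.f i ∈ B.tail k := by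
  intro j hj
  have : j ≠ i := by rintro rfl; omega
  simp [B.form_f_f, B.form_e_f, this]

variable [IsSymplecticForm ω]

theorem form_f_e (i j : Fin n) : ω (B.f i) (B.e j) = if i = j then -1 else 0 := by
  rw [form_swap, B.form_e_f]
  split_ifs with h₁ h₂ h₂
  · rfl
  · exact absurd h₁.symm h₂
  · exact absurd h₂.symm h₁
  · simp

theorem e_mem_tail {i : Fin n} (h : k ≤ i) : B.e i ∈ B.tail k := by
  intro j hj
  have : j ≠ i := by rintro rfl; omega
  simp [B.form_e_e, form_f_e, this]

theorem exists_form_ne_zero {v : V} (hv : v ∈ B.tail k) (h0 : v ≠ 0) :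
    ∃ w ∈ B.tail k, ω v w ≠ 0 := by
  by_contra! H
  refine h0 ?_
  rw [B.expand v]
  refine Finset.sum_eq_zero fun i _ => ?_
  rcases lt_or_ge (i : ℕ) k with hi | hi
  · rw [form_swap, (hv i hi).1, (hv i hi).2]; simp
  · rw [form_swap (B.e i), H _ (e_mem_tail hi), H _ (f_mem_tail hi)]; simp

variable [FiniteDimensional ℝ V]

open SpGroup

theorem shear_mem_fixer {a : V} (ha : a ∈ B.tail k) (c : ℝ) : shear ω a c ∈ B.fixer k := by
  intro i hi
  simp [shear_smul, form_swap (ω := ω) a, ha i hi]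

theorem eichler_mem_fixer {a z : V} (h : ω a z = 0) (ha : a ∈ B.tail k) (hz : z ∈ B.tail k) :
    eichler ω a z h ∈ B.fixer k := by
  intro i hi
  simp [eichler_smul, form_swap (ω := ω) a, form_swap (ω := ω) z, ha i hi, hz i hi]

theorem planeMap_mem_fixer {e f : V} (h : ω e f = 1) (x y x' y' : ℝ) (hd : x * y' - y * x' = 1)
    (he : e ∈ B.tail k) (hf : f ∈ B.tail k) : planeMap ω e f h x y x' y' hd ∈ B.fixer k := by
  intro i hi
  simp [planeMap_smul, form_swap (ω := ω) e, he i hi, hf i hi]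

end SymplecticBasis

namespace SpGroup

variable [IsSymplecticForm ω]

theorem sweep_aux {e f x : V} (h : ω e f = 1) (hx : ω e x = 1) :
    ω e (-(x - f - ω x f • e)) = 0 := by
  simp [h, hx, form_self]

variable [FiniteDimensional ℝ V]

/-- For hyperbolic pairs `(e, f)` and `(e, x)`, a symplectic map that fixes `e` and maps `x`
to `f`. -/
def sweep {e f x : V} (h : ω e f = 1) (hx : ω e x = 1) : SpGroup ω :=
  -- The Eichler factor removes the component of `x` orthogonal to the plane of `e` and `f`; the
  -- shear then removes the multiple of `e`.
  shear ω e (-ω x f) * eichler ω e (-(x - f - ω x f • e)) (sweep_aux h hx)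

theorem sweep_smul_left {e f x : V} (h : ω e f = 1) (hx : ω e x = 1) :
    sweep h hx • e = e := by
  simp [sweep, mul_smul, shear_smul, eichler_smul, form_self, form_swap (ω := ω) x e,
    form_swap (ω := ω) f e, h, hx]

theorem sweep_smul_right {e f x : V} (h : ω e f = 1) (hx : ω e x = 1) :
    sweep h hx • x = f := by
  simp [sweep, mul_smul, shear_smul, eichler_smul, form_self, form_swap (ω := ω) f x, h, hx]
  abel

theorem sweep_mem_fixer {n k : ℕ} {B : SymplecticBasis ω n} {e f x : V} (h : ω e f = 1)
    (hx : ω e x = 1) (he : e ∈ B.tail k) (hf : f ∈ B.tail k) (hxk : x ∈ B.tail k) :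
    sweep h hx ∈ B.fixer k :=
  mul_mem (B.shear_mem_fixer he _) (B.eichler_mem_fixer _ he (neg_mem
    (sub_mem (sub_mem hxk hf) (Submodule.smul_mem _ _ he))))

theorem eichler_zero (a : V) {z : V} (hz : z = 0) (h : ω a z = 0) : eichler ω a z h = 1 :=
  ext_smul fun x => by simp [eichler_smul, hz]

theorem joined_shear (a : V) (c : ℝ) : Joined 1 (shear ω a c) := by
  let _ : TopologicalSpace V := moduleTopology ℝ V
  have : IsModuleTopology ℝ V := ⟨rfl⟩
  simpa using joined_one_of_continuous (fun t => shear ω a (t * c))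
    (continuous_shear continuous_const (by fun_prop)) (by simp [shear_zero])

theorem joined_eichler {a z : V} (h : ω a z = 0) : Joined 1 (eichler ω a z h) := by
  let _ : TopologicalSpace V := moduleTopology ℝ V
  have : IsModuleTopology ℝ V := ⟨rfl⟩
  simpa using joined_one_of_continuous (fun t => eichler ω a (t • z) (form_smul_right_eq_zero h t))
    (continuous_eichler _ continuous_const (by fun_prop)) (eichler_zero _ (by simp) _)

theorem joined_sweep {e f x : V} (h : ω e f = 1) (hx : ω e x = 1) : Joined 1 (sweep h hx) :=
  (joined_shear _ _).mul_of_one (joined_eichler _)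

variable {n k : ℕ} (B : SymplecticBasis ω n)

/-- A transvection in the direction `v - u` moves `u` by `c ω(v, u) (v - u)`; the coefficient is
chosen to make this `v - u`. -/
theorem exists_smul_eq_of_form_ne_zero {u v : V} (hu : u ∈ B.tail k) (hv : v ∈ B.tail k)
    (h : ω u v ≠ 0) : ∃ g ∈ B.fixer k, Joined 1 g ∧ g • u = v := by
  refine ⟨shear ω (v - u) (ω v u)⁻¹, B.shear_mem_fixer (sub_mem hv hu) _, joined_shear _ _, ?_⟩
  have h' : ω v u ≠ 0 := by rwa [form_swap, neg_ne_zero]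
  simp [shear_smul, form_self, h']

/-- The identity component acts transitively on nonzero vectors. -/
theorem exists_smul_eq {u v : V} (hu : u ∈ B.tail k) (hv : v ∈ B.tail k) (hu0 : u ≠ 0)
    (hv0 : v ≠ 0) : ∃ g ∈ B.fixer k, Joined 1 g ∧ g • u = v := by
  -- With a vector `w` that pairs nontrivially with both, two transvections lead from `u` over `w`
  -- to `v`. If neither `a` nor `b` serves for both, their sum does.
  obtain ⟨w, hw, huw, hwv⟩ : ∃ w ∈ B.tail k, ω u w ≠ 0 ∧ ω w v ≠ 0 := by
    obtain ⟨a, ha, hua⟩ := B.exists_form_ne_zero hu hu0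
    obtain ⟨b, hb, hvb⟩ := B.exists_form_ne_zero hv hv0
    by_cases h₁ : ω v a = 0
    · by_cases h₂ : ω u b = 0
      · refine ⟨a + b, add_mem ha hb, ?_, ?_⟩
        · simpa [h₂] using hua
        · rw [form_swap, neg_ne_zero]
          simpa [h₁] using hvb
      · exact ⟨b, hb, h₂, by rwa [form_swap, neg_ne_zero]⟩
    · exact ⟨a, ha, hua, by rwa [form_swap, neg_ne_zero]⟩
  obtain ⟨g, hg, hgj, rfl⟩ := exists_smul_eq_of_form_ne_zero B hu hw huw
  obtain ⟨g', hg', hgj', rfl⟩ := exists_smul_eq_of_form_ne_zero B hw hv hwv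
  exact ⟨g' * g, mul_mem hg' hg, hgj'.mul_of_one hgj, mul_smul _ _ _⟩

/-- The identity component acts transitively on hyperbolic pairs. -/
theorem exists_smul_pair_eq {e f e' f' : V} (he : e ∈ B.tail k) (hf : f ∈ B.tail k)
    (he' : e' ∈ B.tail k) (hf' : f' ∈ B.tail k) (h : ω e f = 1) (h' : ω e' f' = 1) :
    ∃ g ∈ B.fixer k, Joined 1 g ∧ g • e' = e ∧ g • f' = f := by
  obtain ⟨g, hg, hgj, rfl⟩ := exists_smul_eq B he' he (ne_zero_of_form_eq_one h')
    (ne_zero_of_form_eq_one h)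
  have hx : ω (g • e') (g • f') = 1 := by rw [form_smul_smul, h']
  refine ⟨sweep h hx * g,
    mul_mem (sweep_mem_fixer h hx he hf (B.smul_mem_tail hg hf')) hg,
    (joined_sweep h hx).mul_of_one hgj, ?_, ?_⟩
  · rw [mul_smul, sweep_smul_left]
  · rw [mul_smul, sweep_smul_right]

variable (ω) in
/-- The real symplectic group is path connected. -/
theorem joined_one (g : SpGroup ω) : Joined 1 g := by
  obtain ⟨n, ⟨B⟩⟩ := exists_symplecticBasis ω
  -- Induction on the number `m` of hyperbolic pairs that `g` may still move: an element of the
  -- identity component carries the images of the next pair back.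
  have key : ∀ m k, k + m = n → ∀ g ∈ B.fixer k, Joined 1 g := by
    intro m
    induction m with
    | zero =>
      rintro k rfl g hg
      rw [B.eq_one_of_mem_fixer hg]
    | succ m ih =>
      intro k hk g hg
      let i : Fin n := ⟨k, by omega⟩
      have hi : B.e i ∈ B.tail k := B.e_mem_tail le_rfl
      have hi' : B.f i ∈ B.tail k := B.f_mem_tail le_rfl
      obtain ⟨h, hh, hj, h₁, h₂⟩ := exists_smul_pair_eq B hi hi' (B.smul_mem_tail hg hi)
        (B.smul_mem_tail hg hi') (B.form_e_f_self i)
        (by rw [form_smul_smul, B.form_e_f_self])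
      have := ih (k + 1) (by omega) (h * g) ((B.mem_fixer_succ (i := i)).2
        ⟨mul_mem hh hg, by rw [mul_smul, h₁], by rw [mul_smul, h₂]⟩)
      simpa using hj.inv_of_one.mul_of_one this
  exact key n 0 (zero_add n) g (B.fixer_zero g)

end SpGroup

end

/-! ### Paths and loops in the punctured plane -/

noncomputable section

/-- A continuous path in the plane can be approximated by paths that avoid the origin. -/
theorem exists_ne_zero_near (c : C(I, ℂ)) {ε : ℝ} (hε : 0 < ε) :
    ∃ p : C(I, ℂ), (∀ s, p s ≠ 0) ∧ ∀ s, ‖p s - c s‖ < ε := by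
  obtain ⟨p, hp⟩ := exists_polynomial_near_continuousMap 0 1
    ⟨fun s => (c s).re, by fun_prop⟩ (ε / 3) (by positivity)
  obtain ⟨q, hq⟩ := exists_polynomial_near_continuousMap 0 1
    ⟨fun s => (c s).im, by fun_prop⟩ (ε / 3) (by positivity)
  let F : ℝ → ℂ := fun x => p.eval x + q.eval x * Complex.I
  have hF : ContDiff ℝ 1 F := by
    have h₁ : ContDiff ℝ 1 fun x : ℝ => p.eval x := by simpa using p.contDiff_aeval (𝕜 := ℝ) 1
    have h₂ : ContDiff ℝ 1 fun x : ℝ => q.eval x := by simpa using q.contDiff_aeval (𝕜 := ℝ) 1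
    exact (Complex.ofRealCLM.contDiff.comp h₁).add
      ((Complex.ofRealCLM.contDiff.comp h₂).mul contDiff_const)
  -- The polynomial approximation is `C¹`, so its image in the plane has dense complement, and an
  -- arbitrarily small translation moves it off the origin.
  have hd := hF.dense_compl_range_of_finrank_lt_finrank (by simp)
  obtain ⟨w, hw, hw'⟩ := hd.exists_dist_lt 0 (show 0 < ε / 3 by positivity)
  refine ⟨⟨fun s => F s - w, by have := hF.continuous; fun_prop⟩, fun s h => hw ⟨s, ?_⟩, fun s => ?_⟩
  · exact sub_eq_zero.1 h
  · have h₁ : |p.eval (s : ℝ) - (c s).re| < ε / 3 :=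
      lt_of_le_of_lt (ContinuousMap.norm_coe_le_norm
        (p.toContinuousMapOn (Set.Icc 0 1) - ⟨fun s => (c s).re, by fun_prop⟩) s) hp
    have h₂ : |q.eval (s : ℝ) - (c s).im| < ε / 3 :=
      lt_of_le_of_lt (ContinuousMap.norm_coe_le_norm
        (q.toContinuousMapOn (Set.Icc 0 1) - ⟨fun s => (c s).im, by fun_prop⟩) s) hq
    have h₃ : ‖F s - c s‖ ≤ |p.eval (s : ℝ) - (c s).re| + |q.eval (s : ℝ) - (c s).im| := by
      simpa [F] using Complex.norm_le_abs_re_add_abs_im (F s - c s)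
    have h₄ : ‖w‖ < ε / 3 := by simpa [dist_eq_norm] using hw'
    calc ‖F s - w - c s‖ = ‖(F s - c s) - w‖ := by ring_nf
      _ ≤ ‖F s - c s‖ + ‖w‖ := norm_sub_le _ _
      _ < ε := by linarith

/-- The ring of continuous functions on the interval has stable rank two. -/
theorem exists_add_mul_ne_zero (c : C(I, ℂ)) (β : C(I, ℝ)) (hβ : ∀ s, 0 ≤ β s)
    (h : ∀ s, β s = 0 → c s ≠ 0) : ∃ η : C(I, ℂ), ∀ s, c s + β s * η s ≠ 0 := by
  obtain ⟨s₀, -, hs₀⟩ := isCompact_univ.exists_isMinOn (Set.univ_nonempty (α := I))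
    (f := fun s => ‖c s‖ + β s) (by fun_prop)
  set m := ‖c s₀‖ + β s₀
  have hm : 0 < m := by
    rcases (hβ s₀).eq_or_lt with h' | h'
    · have := norm_pos_iff.2 (h s₀ h'.symm)
      have := hβ s₀
      positivity
    · positivity
  have hle : ∀ s, m ≤ ‖c s‖ + β s := fun s => hs₀ (Set.mem_univ s)
  obtain ⟨p, hp, hpc⟩ := exists_ne_zero_near c (half_pos hm)
  have hM : ∀ s, 0 < max (β s) (m / 2) := fun s => lt_max_of_lt_right (half_pos hm)
  -- Where `β ≥ m / 2` the sum equals `p`, which avoids the origin. Elsewhere `‖c‖ > m / 2`, and the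
  -- correction has norm at most `‖p - c‖ < m / 2`.
  refine ⟨⟨fun s => (p s - c s) * ((max (β s) (m / 2))⁻¹ : ℝ), ?_⟩, fun s hs => ?_⟩
  · have : Continuous fun s => (max (β s) (m / 2))⁻¹ :=
      Continuous.inv₀ (by fun_prop) fun s => (hM s).ne'
    fun_prop
  · simp only [ContinuousMap.coe_mk] at hs
    rcases le_or_gt (m / 2) (β s) with h' | h'
    · rw [max_eq_left h'] at hs
      have : (β s : ℂ) ≠ 0 := by
        have : 0 < β s := (half_pos hm).trans_le h'
        exact_mod_cast this.ne'
      refine hp s ?_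
      rw [← hs]
      push_cast
      field_simp
      ring
    · rw [max_eq_right h'.le] at hs
      have h₁ : ‖c s‖ = ‖(p s - c s) * ((m / 2)⁻¹ * β s : ℝ)‖ := by
        refine (congrArg norm (eq_neg_of_add_eq_zero_left hs)).trans ?_
        rw [norm_neg]
        push_cast
        ring_nf
      have h₂ : (m / 2)⁻¹ * β s ≤ 1 := by
        rw [inv_mul_le_iff₀ (half_pos hm)]
        linarith
      have h₃ : 0 ≤ (m / 2)⁻¹ * β s := mul_nonneg (inv_nonneg.2 (half_pos hm).le) (hβ s)
      rw [norm_mul, Complex.norm_real, Real.norm_of_nonneg h₃] at h₁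
      have h₄ : ‖c s‖ ≤ ‖p s - c s‖ := by
        rw [h₁]
        exact mul_le_of_le_one_right (norm_nonneg _) h₂
      have := hpc s
      have := hle s
      linarith

/-- A loop in the punctured plane is the exponential of a path that ends in `2πiℤ`. -/
theorem exists_exp_eq (c : C(I, ℂ)) (hc : ∀ s, c s ≠ 0) (h₀ : c 0 = 1) (h₁ : c 1 = 1) :
    ∃ (φ : C(I, ℂ)) (m : ℤ), (∀ s, Complex.exp (φ s) = c s) ∧ φ 0 = 0 ∧
      φ 1 = 2 * Real.pi * m * Complex.I := by
  let γ : C(I, {z : ℂ // z ≠ 0}) := ⟨fun s => ⟨c s, hc s⟩, by fun_prop⟩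
  have hγ : γ 0 = ⟨Complex.exp 0, Complex.exp_ne_zero _⟩ := Subtype.ext (by simpa [γ] using h₀)
  have hl := Complex.isCoveringMap_exp.liftPath_lifts γ 0 hγ
  set φ := Complex.isCoveringMap_exp.liftPath γ 0 hγ with hφ
  have hl' : ∀ s, Complex.exp (φ s) = c s := fun s => congrArg Subtype.val (congrFun hl s)
  obtain ⟨m, hm⟩ := Complex.exp_eq_one_iff.1 ((hl' 1).trans h₁)
  exact ⟨φ, m, hl', Complex.isCoveringMap_exp.liftPath_zero γ 0 hγ, by rw [hm]; ring⟩

/-- The standard loops in the punctured plane are essential. -/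
theorem eq_zero_of_homotopicRel {m : ℤ} {γ : C(I, {z : ℂ // z ≠ 0})}
    {δ : C(I, {z : ℂ // z ≠ 0})} (hγ : ∀ s : I, (γ s : ℂ) = Complex.exp (2 * Real.pi * m * s * Complex.I))
    (hδ : ∀ s, (δ s : ℂ) = 1) (h : γ.HomotopicRel δ {0, 1}) : m = 0 := by
  -- The homotopy lifts through `exp`, so the lifts `2πims` and `0` have the same end point.
  have key := (Complex.isCoveringMap_exp.homotopicRel_iff_comp (A := I)
    (f₀ := ⟨fun s => 2 * Real.pi * m * s * Complex.I, by fun_prop⟩) (f₁ := ContinuousMap.const I 0)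
    (S := {0, 1}) ⟨0, by simp, by simp⟩).2 (by
      convert h using 1
      · ext s; simp [hγ]
      · ext s; simp [hδ])
  have := key.fst_eq_snd (show (1 : I) ∈ _ by simp)
  simpa [Real.pi_ne_zero] using this

end

/-! ### The compatible complex structure, rotations and contractible loops -/

noncomputable section

variable {V : Type*} [AddCommGroup V] [Module ℝ V] {ω : LinearMap.BilinForm ℝ V}

namespace SymplecticBasis

variable {n : ℕ} (B : SymplecticBasis ω n)

/-- The complex structure `e ↦ f ↦ -e` of a symplectic basis. -/
def complexStructure : V →ₗ[ℝ] V :=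
  ∑ i, ((ω.flip (B.f i)).smulRight (B.f i) + (ω (B.e i)).smulRight (-B.e i))

theorem complexStructure_apply (v : V) :
    B.complexStructure v = ∑ i, (ω v (B.f i) • B.f i - ω (B.e i) v • B.e i) := by
  simp [complexStructure, LinearMap.sum_apply, sub_eq_add_neg]

theorem form_e_complexStructure (j : Fin n) (v : V) :
    ω (B.e j) (B.complexStructure v) = ω v (B.f j) := by
  simp [complexStructure_apply, B.form_e_e, B.form_e_f]

variable [IsSymplecticForm ω]

theorem form_f_complexStructure (j : Fin n) (v : V) :
    ω (B.f j) (B.complexStructure v) = ω (B.e j) v := by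
  simp [complexStructure_apply, B.form_f_f, B.form_f_e]

/-- Compatibility of the complex structure `J` with the form: `ω(v, Jv)` is positive definite. It
supplies the function `β` for `exists_add_mul_ne_zero` and makes frame determinants nonzero. -/
theorem form_complexStructure_self (v : V) :
    ω v (B.complexStructure v) = ∑ i, (ω v (B.f i) ^ 2 + ω (B.e i) v ^ 2) := by
  simp only [complexStructure_apply, map_sum, map_sub, map_smul, smul_eq_mul,
    form_swap (ω := ω) v (B.e _)]
  exact Finset.sum_congr rfl fun i _ => by ring

theorem form_complexStructure_nonneg (v : V) : 0 ≤ ω v (B.complexStructure v) := by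
  rw [form_complexStructure_self]
  positivity

theorem eq_zero_of_form_complexStructure {v : V} (h : ω v (B.complexStructure v) = 0) :
    v = 0 := by
  rw [form_complexStructure_self, Finset.sum_eq_zero_iff_of_nonneg (fun i _ => by positivity)] at h
  rw [B.expand v]
  refine Finset.sum_eq_zero fun i hi => ?_
  have := h i hi
  have h₁ : ω v (B.f i) = 0 := by nlinarith [sq_nonneg (ω v (B.f i)), sq_nonneg (ω (B.e i) v)]
  have h₂ : ω (B.e i) v = 0 := by nlinarith [sq_nonneg (ω v (B.f i)), sq_nonneg (ω (B.e i) v)]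
  simp [h₁, h₂]

theorem complexStructure_mem_tail {k : ℕ} {v : V} (hv : v ∈ B.tail k) :
    B.complexStructure v ∈ B.tail k := by
  intro j hj
  rw [form_e_complexStructure, form_f_complexStructure, form_swap, (hv j hj).1, (hv j hj).2]
  simp

end SymplecticBasis

namespace SpGroup

variable [IsSymplecticForm ω] [FiniteDimensional ℝ V]

variable (ω) in
/-- The symplectic map that fixes the orthogonal complement of the hyperbolic pair `(e, f)` and
maps `e` to `r (cos θ e + sin θ f)` and `f` to `r⁻¹ (- sin θ e + cos θ f)`, where `r = exp ρ`. -/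
def planePolar (e f : V) (h : ω e f = 1) (ρ θ : ℝ) : SpGroup ω :=
  planeMap ω e f h (Real.exp ρ * Real.cos θ) (Real.exp ρ * Real.sin θ)
    (-(Real.exp (-ρ) * Real.sin θ)) (Real.exp (-ρ) * Real.cos θ) (by
      have h₁ : Real.exp ρ * Real.exp (-ρ) = 1 := by rw [← Real.exp_add]; simp
      linear_combination h₁ + Real.exp ρ * Real.exp (-ρ) * Real.sin_sq_add_cos_sq θ)

variable {e f : V} (h : ω e f = 1)

theorem planePolar_smul_left (ρ θ : ℝ) : planePolar ω e f h ρ θ • e =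
    (Real.exp ρ * Real.cos θ) • e + (Real.exp ρ * Real.sin θ) • f := by
  simp [planePolar, planeMap_smul, h, form_self]
  module

theorem planePolar_mem_fixer {n k : ℕ} {B : SymplecticBasis ω n} (he : e ∈ B.tail k)
    (hf : f ∈ B.tail k) (ρ θ : ℝ) : planePolar ω e f h ρ θ ∈ B.fixer k :=
  B.planeMap_mem_fixer h _ _ _ _ _ he hf

theorem planePolar_zero_of_cos_eq_one {θ : ℝ} (hθ : Real.cos θ = 1) :
    planePolar ω e f h 0 θ = 1 := by
  have hs : Real.sin θ = 0 := by
    have := Real.sin_sq_add_cos_sq θ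
    rw [hθ] at this
    nlinarith
  exact ext_smul fun x => by simp [planePolar, planeMap_smul, hθ, hs]

theorem planePolar_add (θ θ' : ℝ) :
    planePolar ω e f h 0 (θ + θ') = planePolar ω e f h 0 θ * planePolar ω e f h 0 θ' := by
  refine ext_smul fun x => ?_
  simp only [mul_smul, planePolar, planeMap_smul, map_add, map_smul, LinearMap.add_apply,
    LinearMap.smul_apply, smul_eq_mul, h, form_self, Real.cos_add,
    Real.sin_add, Real.exp_zero, neg_zero]
  module

theorem conj_planePolar (g : SpGroup ω) (h' : ω (g • e) (g • f) = 1) (ρ θ : ℝ) :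
    planePolar ω (g • e) (g • f) h' ρ θ = g * planePolar ω e f h ρ θ * g⁻¹ := by
  rw [eq_mul_inv_iff_mul_eq]
  refine ext_smul fun x => ?_
  simp only [mul_smul, planePolar, planeMap_smul, smul_add, form_smul_smul, smul_comm g]

theorem continuous_planePolar {T : Type*} [TopologicalSpace T] {ρ θ : T → ℝ} (hρ : Continuous ρ)
    (hθ : Continuous θ) : Continuous fun t => planePolar ω e f h (ρ t) (θ t) := by
  let _ : TopologicalSpace V := moduleTopology ℝ V
  have : IsModuleTopology ℝ V := ⟨rfl⟩
  exact continuous_planeMap e f h _ (by fun_prop) (by fun_prop) (by fun_prop) (by fun_prop)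

/-- The loop that turns `m` times in the plane spanned by `e` and `f`. -/
def rotPath (m : ℤ) : C(I, SpGroup ω) :=
  ⟨fun s => planePolar ω e f h 0 (2 * Real.pi * m * s),
    continuous_planePolar h continuous_const (by fun_prop)⟩

theorem rotPath_apply (m : ℤ) (s : I) :
    rotPath h m s = planePolar ω e f h 0 (2 * Real.pi * m * s) := rfl

theorem cos_two_pi_mul_int (m : ℤ) : Real.cos (2 * Real.pi * m) = 1 := by
  rw [mul_comm]
  exact Real.cos_int_mul_two_pi m

theorem rotPath_zero (m : ℤ) : rotPath h m 0 = 1 :=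
  planePolar_zero_of_cos_eq_one h (by simp)

theorem rotPath_one (m : ℤ) : rotPath h m 1 = 1 :=
  planePolar_zero_of_cos_eq_one h (by simpa using cos_two_pi_mul_int m)

open UniversalCover

/-- The class of the loop that turns `m` times in the plane spanned by `e` and `f`. -/
def rotClass (m : ℤ) : SpTilde ω := mk (rotPath h m) (rotPath_zero h m)

theorem rotClass_add (m m' : ℤ) : rotClass h (m + m') = rotClass h m * rotClass h m' := by
  rw [rotClass, rotClass, rotClass, mk_mul_mk]
  congr 1
  ext1 s
  rw [ContinuousMap.mul_apply, rotPath_apply, rotPath_apply, rotPath_apply, ← planePolar_add]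
  push_cast
  ring_nf

theorem rotClass_mem_ker (m : ℤ) : rotClass h m ∈ (projHom (SpGroup ω)).ker := rotPath_one h m

/-- The classes of rotations do not depend on the hyperbolic pair. -/
theorem rotClass_eq {e' f' : V} (h' : ω e' f' = 1) (m : ℤ) : rotClass h m = rotClass h' m := by
  obtain ⟨n, ⟨B⟩⟩ := exists_symplecticBasis ω
  obtain ⟨g, -, hg, rfl, rfl⟩ := exists_smul_pair_eq B (B.tail_zero e') (B.tail_zero f')
    (B.tail_zero e) (B.tail_zero f) h' h
  exact mk_conj_of_joined hg _ (rotPath_one h m) _ fun s => conj_planePolar h g h' _ _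

/-- Polar loops in a hyperbolic plane are homotopic to rotations. -/
theorem mk_planePolar_eq (φ : C(I, ℂ)) {m : ℤ} (h₀ : φ 0 = 0)
    (h₁ : φ 1 = 2 * Real.pi * m * Complex.I) (γ : C(I, SpGroup ω)) (hγ₀ : γ 0 = 1)
    (hγ : ∀ s, γ s = planePolar ω e f h (φ s).re (φ s).im) :
    mk γ hγ₀ = rotClass h m := by
  have hre : (φ 1).re = 0 := by simp [h₁]
  have him : (φ 1).im = 2 * Real.pi * m := by simp [h₁]
  -- Logarithmic radius and angle are interpolated linearly between `φ` and the standard rotation;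
  -- the two have the same ends.
  refine mk_eq_of_homotopy (fun t s => planePolar ω e f h ((1 - t) * (φ s).re)
    ((1 - t) * (φ s).im + t * (2 * Real.pi * m * s))) ?_ ?_ ?_ ?_ ?_
  · exact continuous_planePolar h (by fun_prop) (by fun_prop)
  · intro s; simp [hγ]
  · intro s; simp [rotPath_apply]
  · intro t; simpa [h₀] using planePolar_zero_of_cos_eq_one h (by simp)
  · intro t
    rw [hγ, hre, him]
    congr 1
    · simp
    · simp; ring

section Null

variable [TopologicalSpace V] [IsModuleTopology ℝ V]

/-- Loops of Eichler transformations are contractible. -/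
theorem mk_eichler {a z : I → V} (h : ∀ s, ω (a s) (z s) = 0) (ha : Continuous a)
    (hz : Continuous z) (hz₀ : z 0 = 0) (hz₁ : z 1 = 0) (γ : C(I, SpGroup ω)) (hγ₀ : γ 0 = 1)
    (hγ : ∀ s, γ s = eichler ω (a s) (z s) (h s)) : mk γ hγ₀ = 1 := by
  -- Scaling `z` preserves `ω(a, z) = 0`. The path `a` need not be closed, because `z` vanishes at
  -- both ends.
  refine mk_eq_one_of_homotopy (fun t s => eichler ω (a s) ((t : ℝ) • z s)
    (form_smul_right_eq_zero (h s) _)) ?_ ?_ ?_ ?_ ?_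
  · exact continuous_eichler (a := fun p : I × I => a p.2) (z := fun p : I × I => (p.1 : ℝ) • z p.2)
      _ (by fun_prop) (by fun_prop)
  · intro s; exact eichler_zero _ (by simp) _
  · intro s; simp [hγ]
  · intro t; exact eichler_zero _ (by simp [hz₀]) _
  · intro t; exact eichler_zero _ (by simp [hz₁]) _

/-- Loops of transvections with a fixed direction are contractible. -/
theorem mk_shear (a : V) {c : I → ℝ} (hc : Continuous c) (hc₀ : c 0 = 0) (hc₁ : c 1 = 0)
    (γ : C(I, SpGroup ω)) (hγ₀ : γ 0 = 1) (hγ : ∀ s, γ s = shear ω a (c s)) : mk γ hγ₀ = 1 := by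
  refine mk_eq_one_of_homotopy (fun t s => shear ω a (t * c s)) ?_ ?_ ?_ ?_ ?_
  · exact continuous_shear (T := I × I) continuous_const (by fun_prop)
  · intro s; simp [shear_zero]
  · intro s; simp [hγ]
  · intro t; simp [hc₀, shear_zero]
  · intro t; simp [hc₁, shear_zero]

end Null

end SpGroup

end

/-! ### The fundamental group is generated by a rotation -/

noncomputable section

variable {V : Type*} [AddCommGroup V] [Module ℝ V] {ω : LinearMap.BilinForm ℝ V}

namespace SpGroup

open UniversalCover SymplecticBasis

section Plane

/-- The component orthogonal to the hyperbolic pair `(e, f)`. -/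
def planeCompl (ω : LinearMap.BilinForm ℝ V) (e f u : V) : V := u - ω u f • e - ω e u • f

theorem continuous_planeCompl [FiniteDimensional ℝ V] [TopologicalSpace V] [IsModuleTopology ℝ V]
    (e f : V) {u : I → V} (hu : Continuous u) : Continuous fun s => planeCompl ω e f (u s) := by
  have := IsModuleTopology.topologicalAddGroup ℝ V
  have h₁ : Continuous fun s => ω (u s) f := hu.form continuous_const
  have h₂ : Continuous fun s => ω e (u s) := continuous_const.form hu
  exact (hu.sub (h₁.smul continuous_const)).sub (h₂.smul continuous_const)

variable [IsSymplecticForm ω]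

theorem planeCompl_self {e f : V} (h : ω e f = 1) : planeCompl ω e f e = 0 := by
  simp [planeCompl, h, form_self]

theorem form_left_planeCompl {e f : V} (h : ω e f = 1) (u : V) :
    ω e (planeCompl ω e f u) = 0 := by
  simp [planeCompl, h, form_self]

theorem form_right_planeCompl {e f : V} (h : ω e f = 1) (u : V) :
    ω f (planeCompl ω e f u) = 0 := by
  simp [planeCompl, h, form_self, form_swap (ω := ω) f e, form_swap (ω := ω) f u]

theorem planeCompl_mem_tail {n : ℕ} {B : SymplecticBasis ω n} {i : Fin n} {u : V}
    (hu : u ∈ B.tail i) : planeCompl ω (B.e i) (B.f i) u ∈ B.tail (i + 1) := by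
  intro j hj
  rcases Nat.lt_succ_iff_lt_or_eq.1 hj with hj | hj
  · have hu' : planeCompl ω (B.e i) (B.f i) u ∈ B.tail i :=
      sub_mem (sub_mem hu (Submodule.smul_mem _ _ (e_mem_tail le_rfl)))
        (Submodule.smul_mem _ _ (f_mem_tail le_rfl))
    exact hu' j hj
  · rw [Fin.ext hj]
    exact ⟨form_left_planeCompl (B.form_e_f_self i) u, form_right_planeCompl (B.form_e_f_self i) u⟩

theorem form_planeCompl_right {e f z : V} (h₁ : ω e z = 0) (h₂ : ω f z = 0) (u : V) :
    ω z (planeCompl ω e f u) = ω z u := by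
  simp [planeCompl, form_swap (ω := ω) z e, form_swap (ω := ω) z f, h₁, h₂]

end Plane

variable [IsSymplecticForm ω] [FiniteDimensional ℝ V]

/-- A loop under which the image of `e` remains in the hyperbolic plane spanned by `e` and `f` is
the product of a rotation and of a loop that fixes `e`. -/
theorem exists_mul_smul_left_eq {n : ℕ} {B : SymplecticBasis ω n} {i : Fin n}
    (l : C(I, SpGroup ω)) (h₀ : l 0 = 1) (h₁ : l 1 = 1)
    (x y : C(I, ℝ)) (hxy : ∀ s, x s ≠ 0 ∨ y s ≠ 0)
    (hle : ∀ s, l s • B.e i = x s • B.e i + y s • B.f i) :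
    ∃ (r : C(I, SpGroup ω)) (hr : r 0 = 1), r 1 = 1 ∧
      (∃ m : ℤ, mk r hr = rotClass (B.form_e_f_self i) m) ∧ (∀ s, r s ∈ B.fixer i) ∧
      ∀ s, ((r s)⁻¹ * l s) • B.e i = B.e i := by
  have hef : ω (B.e i) (B.f i) = 1 := B.form_e_f_self i
  have hend : ∀ s, l s = 1 → x s = 1 ∧ y s = 0 := fun s hs => by
    have h := hle s
    rw [hs, one_smul] at h
    have hx := congrArg (fun v => ω v (B.f i)) h
    have hy := congrArg (fun v => ω (B.e i) v) h
    simp [hef, form_self] at hx hy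
    exact ⟨hx.symm, hy.symm⟩
  -- Polar coordinates for the image of `e`: the real part of `φ` is the logarithm of the radius,
  -- the imaginary part a continuous angle.
  obtain ⟨φ, m, hφ, hφ₀, hφ₁⟩ := exists_exp_eq ⟨fun s => x s + y s * Complex.I, by fun_prop⟩
    (fun s hs => (hxy s).elim
      (fun h => h (by simpa using congrArg Complex.re hs))
      (fun h => h (by simpa using congrArg Complex.im hs)))
    (by simp [(hend 0 h₀).1, (hend 0 h₀).2]) (by simp [(hend 1 h₁).1, (hend 1 h₁).2])
  let r : C(I, SpGroup ω) := ⟨fun s => planePolar ω (B.e i) (B.f i) hef (φ s).re (φ s).im,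
    continuous_planePolar hef (by fun_prop) (by fun_prop)⟩
  have hr₀ : r 0 = 1 := by
    change planePolar ω (B.e i) (B.f i) hef (φ 0).re (φ 0).im = 1
    rw [hφ₀]
    exact planePolar_zero_of_cos_eq_one hef (by simp)
  have hr₁ : r 1 = 1 := by
    change planePolar ω (B.e i) (B.f i) hef (φ 1).re (φ 1).im = 1
    rw [hφ₁]
    simpa using planePolar_zero_of_cos_eq_one hef (cos_two_pi_mul_int m)
  refine ⟨r, hr₀, hr₁, ⟨m, mk_planePolar_eq hef φ hφ₀ hφ₁ r hr₀ fun _ => rfl⟩,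
    fun s => planePolar_mem_fixer hef (e_mem_tail le_rfl) (f_mem_tail le_rfl) _ _,
    fun s => ?_⟩
  rw [mul_smul, inv_smul_eq_iff, hle]
  change _ = planePolar ω (B.e i) (B.f i) hef (φ s).re (φ s).im • B.e i
  have h := hφ s
  have hx : Real.exp (φ s).re * Real.cos (φ s).im = x s := by
    rw [← Complex.exp_re, h]; simp
  have hy : Real.exp (φ s).re * Real.sin (φ s).im = y s := by
    rw [← Complex.exp_im, h]; simp
  rw [planePolar_smul_left, hx, hy]

section Step

variable [TopologicalSpace V] [IsModuleTopology ℝ V] {n : ℕ} {B : SymplecticBasis ω n} {i : Fin n}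

/-- A loop in the symplectic group can be deformed so that the component of the image of `e` in the
hyperbolic plane spanned by `e` and `f` never vanishes. -/
theorem exists_mul_coord_ne_zero (l : C(I, SpGroup ω)) (h₀ : l 0 = 1) (h₁ : l 1 = 1)
    (hl : ∀ s, l s ∈ B.fixer i) :
    ∃ (r : C(I, SpGroup ω)) (hr : r 0 = 1), r 1 = 1 ∧ mk r hr = 1 ∧ (∀ s, r s ∈ B.fixer i) ∧
      ∀ s, ω ((r s * l s) • B.e i) (B.f i) ≠ 0 ∨ ω (B.e i) ((r s * l s) • B.e i) ≠ 0 := by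
  have := IsModuleTopology.topologicalAddGroup ℝ V
  set e := B.e i
  set f := B.f i
  have hef : ω e f = 1 := B.form_e_f_self i
  have he : e ∈ B.tail i := e_mem_tail le_rfl
  have hf : f ∈ B.tail i := f_mem_tail le_rfl
  let u : I → V := fun s => l s • e
  have hu : Continuous u := by fun_prop
  have hut : ∀ s, u s ∈ B.tail i := fun s => B.smul_mem_tail (hl s) he
  let q : I → V := fun s => planeCompl ω e f (u s)
  have hq : Continuous q := continuous_planeCompl e f hu
  have hqt : ∀ s, q s ∈ B.tail (i + 1) := fun s => planeCompl_mem_tail (hut s)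
  -- With this choice `ω(z, u) = ω(q, Jq) ≥ 0`, with equality only where `q = 0`; there `u` lies in
  -- the plane and is not zero.
  let z : I → V := fun s => -B.complexStructure (q s)
  have hz : Continuous z :=
    ((IsModuleTopology.continuous_of_linearMap B.complexStructure).comp hq).neg
  have hzt : ∀ s, z s ∈ B.tail (i + 1) := fun s => neg_mem (B.complexStructure_mem_tail (hqt s))
  have hez : ∀ s, ω e (z s) = 0 := fun s => (hzt s i (Nat.lt_succ_self _)).1
  have hfz : ∀ s, ω f (z s) = 0 := fun s => (hzt s i (Nat.lt_succ_self _)).2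
  have hzu : ∀ s, ω (z s) (u s) = ω (q s) (B.complexStructure (q s)) := fun s => by
    rw [← form_planeCompl_right (hez s) (hfz s)]
    change ω (-B.complexStructure (q s)) (q s) = _
    rw [form_swap (q s)]
    simp
  have hx : Continuous fun s => ω (u s) f := hu.form continuous_const
  have hy : Continuous fun s => ω e (u s) := continuous_const.form hu
  obtain ⟨η, hη⟩ := exists_add_mul_ne_zero
    ⟨fun s => ω (u s) f + ω e (u s) * Complex.I, (Complex.continuous_ofReal.comp hx).add
      ((Complex.continuous_ofReal.comp hy).mul continuous_const)⟩
    ⟨fun s => ω (z s) (u s), hz.form hu⟩ (fun s => by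
      simpa [hzu] using B.form_complexStructure_nonneg (q s)) (fun s hs hc => by
      have hq0 : q s = 0 := B.eq_zero_of_form_complexStructure ((hzu s).symm.trans hs)
      have h₁ : ω (u s) f = 0 := by simpa using congrArg Complex.re hc
      have h₂ : ω e (u s) = 0 := by simpa using congrArg Complex.im hc
      have : u s = 0 := by simpa [q, planeCompl, h₁, h₂] using hq0
      refine ne_zero_of_form_eq_one hef ?_
      simpa [u, smul_eq_zero_iff_eq] using this)
  -- The Eichler transformation for this `a` changes the complex plane coordinate `c` of `u` into `c
  -- + ω(z, u) η`, which has no zero by the choice of `η`.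
  let a : I → V := fun s => (η s).re • e + (η s).im • f
  have ha : Continuous a := by fun_prop
  have haz : ∀ s, ω (a s) (z s) = 0 := fun s => by simp [a, hez, hfz]
  have hend : ∀ s, l s = 1 → z s = 0 := fun s hs => by
    simp [z, q, u, hs, planeCompl_self hef]
  let r : C(I, SpGroup ω) := ⟨fun s => eichler ω (a s) (z s) (haz s), continuous_eichler _ ha hz⟩
  refine ⟨r, eichler_zero _ (hend 0 h₀) (haz 0), eichler_zero _ (hend 1 h₁) (haz 1),
    mk_eichler haz ha hz (hend 0 h₀) (hend 1 h₁) r _ fun _ => rfl, fun s => ?_, fun s => ?_⟩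
  · refine B.eichler_mem_fixer (haz s) (add_mem (Submodule.smul_mem _ _ he) (Submodule.smul_mem _ _ hf))
      fun j hj => hzt s j (by omega)
  · have h₁ : ω ((r s * l s) • e) f = ω (u s) f + ω (z s) (u s) * (η s).re := by
      change ω ((eichler ω (a s) (z s) (haz s) * l s) • e) f = _
      simp [mul_smul, eichler_smul, a, form_swap (ω := ω) (z s) f, hfz, hef, form_self, u]
    have h₂ : ω e ((r s * l s) • e) = ω e (u s) + ω (z s) (u s) * (η s).im := by
      change ω e ((eichler ω (a s) (z s) (haz s) * l s) • e) = _
      simp [mul_smul, eichler_smul, a, hez, hef, form_self, u]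
    by_contra! H
    rw [h₁, h₂] at H
    refine hη s (Complex.ext ?_ ?_)
    · simpa using H.1
    · simpa using H.2

/-- If the component of the image of `e` in the hyperbolic plane never vanishes, then the loop can
be deformed so that the image of `e` remains in this plane. -/
theorem exists_mul_mem_plane (l : C(I, SpGroup ω)) (h₀ : l 0 = 1) (h₁ : l 1 = 1)
    (hl : ∀ s, l s ∈ B.fixer i)
    (hne : ∀ s, ω (l s • B.e i) (B.f i) ≠ 0 ∨ ω (B.e i) (l s • B.e i) ≠ 0) :
    ∃ (r : C(I, SpGroup ω)) (hr : r 0 = 1), r 1 = 1 ∧ mk r hr = 1 ∧ (∀ s, r s ∈ B.fixer i) ∧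
      ∀ s, (r s * l s) • B.e i =
        ω (l s • B.e i) (B.f i) • B.e i + ω (B.e i) (l s • B.e i) • B.f i := by
  have := IsModuleTopology.topologicalAddGroup ℝ V
  set e := B.e i
  set f := B.f i
  have hef : ω e f = 1 := B.form_e_f_self i
  have he : e ∈ B.tail i := e_mem_tail le_rfl
  have hf : f ∈ B.tail i := f_mem_tail le_rfl
  let u : I → V := fun s => l s • e
  have hu : Continuous u := by fun_prop
  have hut : ∀ s, u s ∈ B.tail i := fun s => B.smul_mem_tail (hl s) he
  let z : I → V := fun s => -planeCompl ω e f (u s)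
  have hz : Continuous z := (continuous_planeCompl e f hu).neg
  have hzt : ∀ s, z s ∈ B.tail (i + 1) := fun s => neg_mem (planeCompl_mem_tail (hut s))
  have hez : ∀ s, ω e (z s) = 0 := fun s => (hzt s i (Nat.lt_succ_self _)).1
  have hfz : ∀ s, ω f (z s) = 0 := fun s => (hzt s i (Nat.lt_succ_self _)).2
  let x : I → ℝ := fun s => ω (u s) f
  let y : I → ℝ := fun s => ω e (u s)
  have hx : Continuous x := hu.form continuous_const
  have hy : Continuous y := continuous_const.form hu
  have hd : ∀ s, x s ^ 2 + y s ^ 2 ≠ 0 := fun s => by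
    rcases hne s with h | h
    · have : 0 < x s ^ 2 := sq_pos_of_ne_zero h
      positivity
    · have : 0 < y s ^ 2 := sq_pos_of_ne_zero h
      positivity
  -- Normalised so that `ω(a, u) = 1`. As `ω(z, u) = 0`, the Eichler transformation sends `u` to `u
  -- + z`, its component in the plane.
  let a : I → V := fun s => (x s ^ 2 + y s ^ 2)⁻¹ • (y s • e - x s • f)
  have ha : Continuous a :=
    Continuous.smul (Continuous.inv₀ (by fun_prop) hd) (by fun_prop)
  have haz : ∀ s, ω (a s) (z s) = 0 := fun s => by simp [a, hez, hfz]
  have hend : ∀ s, l s = 1 → z s = 0 := fun s hs => by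
    simp [z, u, hs, planeCompl_self hef]
  let r : C(I, SpGroup ω) := ⟨fun s => eichler ω (a s) (z s) (haz s), continuous_eichler _ ha hz⟩
  refine ⟨r, eichler_zero _ (hend 0 h₀) (haz 0), eichler_zero _ (hend 1 h₁) (haz 1),
    mk_eichler haz ha hz (hend 0 h₀) (hend 1 h₁) r _ fun _ => rfl, fun s => ?_, fun s => ?_⟩
  · refine B.eichler_mem_fixer (haz s) (Submodule.smul_mem _ _ (sub_mem (Submodule.smul_mem _ _ he)
      (Submodule.smul_mem _ _ hf))) fun j hj => hzt s j (by omega)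
  · have h₁ : ω (a s) (u s) = 1 := by
      have : ω f (u s) = -x s := form_swap _ _
      have h' : ω e (u s) = y s := rfl
      have := hd s
      simp [a, *]
      field_simp
      ring
    have h₂ : ω (z s) (u s) = 0 := by
      rw [← form_planeCompl_right (hez s) (hfz s)]
      simp [z, form_self]
    change (eichler ω (a s) (z s) (haz s) * l s) • e = ω (u s) f • e + ω e (u s) • f
    rw [mul_smul, eichler_smul]
    change u s + ω (a s) (u s) • z s + ω (z s) (u s) • a s = _
    rw [h₁, h₂]
    change u s + (1 : ℝ) • -(u s - ω (u s) f • e - ω e (u s) • f) + (0 : ℝ) • a s = _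
    generalize u s = v
    module

/-- A loop that fixes `e` can be deformed to fix `f`. -/
theorem exists_mul_smul_right_eq (l : C(I, SpGroup ω)) (h₀ : l 0 = 1) (h₁ : l 1 = 1)
    (hl : ∀ s, l s ∈ B.fixer i) (hle : ∀ s, l s • B.e i = B.e i) :
    ∃ (r : C(I, SpGroup ω)) (hr : r 0 = 1), r 1 = 1 ∧ mk r hr = 1 ∧
      (∀ s, r s * l s ∈ B.fixer (i + 1)) := by
  have := IsModuleTopology.topologicalAddGroup ℝ V
  set e := B.e i with he_def
  set f := B.f i with hf_def
  have hef : ω e f = 1 := B.form_e_f_self i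
  have he : e ∈ B.tail i := e_mem_tail le_rfl
  have hf : f ∈ B.tail i := f_mem_tail le_rfl
  let x : I → V := fun s => l s • f
  have hxc : Continuous x := by fun_prop
  have hx : ∀ s, ω e (x s) = 1 := fun s => by
    rw [← hef, ← form_smul_smul (l s) e f, hle]
  have hc : Continuous fun s => -ω (x s) f := (hxc.form continuous_const).neg
  let z : I → V := fun s => -(x s - f - ω (x s) f • e)
  have hz : Continuous z :=
    ((hxc.sub continuous_const).sub ((hxc.form continuous_const).smul continuous_const)).neg
  have hxe : ∀ s, l s = 1 → x s = f := fun s hs => by simp [x, hs]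
  have hze : ∀ s, l s = 1 → z s = 0 := fun s hs => by simp [z, hxe s hs, form_self]
  have hce : ∀ s, l s = 1 → -ω (x s) f = 0 := fun s hs => by simp [hxe s hs, form_self]
  -- The product `r₁ * r₂` is the path of maps `sweep` that take `l s • f` back to `f`; both factors
  -- are contractible loops.
  let r₁ : C(I, SpGroup ω) := ⟨_, continuous_shear (continuous_const (y := e)) hc⟩
  let r₂ : C(I, SpGroup ω) :=
    ⟨_, continuous_eichler (fun s => sweep_aux hef (hx s)) continuous_const hz⟩
  have hr₁ : ∀ s, l s = 1 → r₁ s = 1 := fun s hs => by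
    change shear ω e (-ω (x s) f) = 1
    rw [hce s hs, shear_zero]
  have hr₂ : ∀ s, l s = 1 → r₂ s = 1 := fun s hs => eichler_zero _ (hze s hs) (sweep_aux hef (hx s))
  have hm₁ : mk r₁ (hr₁ 0 h₀) = 1 := mk_shear e hc (hce 0 h₀) (hce 1 h₁) r₁ _ fun _ => rfl
  have hm₂ : mk r₂ (hr₂ 0 h₀) = 1 :=
    mk_eichler (fun s => sweep_aux hef (hx s)) continuous_const hz (hze 0 h₀) (hze 1 h₁) r₂ _ fun _ => rfl
  refine ⟨r₁ * r₂, by simp [hr₁ 0 h₀, hr₂ 0 h₀], by simp [hr₁ 1 h₁, hr₂ 1 h₁], ?_, fun s => ?_⟩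
  · rw [← mk_mul_mk r₁ r₂ (hr₁ 0 h₀) (hr₂ 0 h₀), hm₁, hm₂, one_mul]
  · change sweep hef (hx s) * l s ∈ _
    rw [B.mem_fixer_succ, ← he_def, ← hf_def]
    refine ⟨mul_mem (sweep_mem_fixer hef (hx s) he hf (B.smul_mem_tail (hl s) hf)) (hl s), ?_, ?_⟩
    · rw [mul_smul, hle, sweep_smul_left]
    · rw [mul_smul, sweep_smul_right]

end Step

/-- Every loop in the symplectic group is homotopic to a rotation in a hyperbolic plane. -/
theorem exists_eq_rotClass {e f : V} (h : ω e f = 1) {z : SpTilde ω}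
    (hz : z ∈ (projHom (SpGroup ω)).ker) : ∃ m : ℤ, z = rotClass h m := by
  let _ : TopologicalSpace V := moduleTopology ℝ V
  have : IsModuleTopology ℝ V := ⟨rfl⟩
  obtain ⟨n, ⟨B⟩⟩ := exists_symplecticBasis ω
  -- Induction on the number of hyperbolic pairs that the loop may still move. Each step costs one
  -- rotation and otherwise only contractible factors.
  have key : ∀ m k, k + m = n → ∀ (l : C(I, SpGroup ω)) (h₀ : l 0 = 1), l 1 = 1 →
      (∀ s, l s ∈ B.fixer k) → ∃ m : ℤ, mk l h₀ = rotClass h m := by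
    intro m
    induction m with
    | zero =>
      rintro k rfl l h₀ - hl
      refine ⟨0, mk_eq_of_homotopy (fun _ _ => 1) continuous_const (fun s => ?_) (fun s => ?_)
        (fun _ => rfl) (fun t => ?_)⟩
      · exact (B.eq_one_of_mem_fixer (hl s)).symm
      · exact (planePolar_zero_of_cos_eq_one h (by simp)).symm
      · exact (B.eq_one_of_mem_fixer (hl 1)).symm
    | succ m ih =>
      intro k hk l h₀ h₁ hl
      let i : Fin n := ⟨k, by omega⟩
      obtain ⟨r, hr₀, hr₁, hr, hrf, hne⟩ := exists_mul_coord_ne_zero (i := i) l h₀ h₁ hl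
      obtain ⟨r', hr₀', hr₁', hr', hrf', hpl⟩ := exists_mul_mem_plane (i := i) (r * l)
        (by simp [hr₀, h₀]) (by simp [hr₁, h₁]) (fun s => mul_mem (hrf s) (hl s)) hne
      have hu : Continuous fun s => (r * l) s • B.e i := by fun_prop
      obtain ⟨R, hR₀, hR₁, ⟨a, ha⟩, hRf, hRe⟩ := exists_mul_smul_left_eq (i := i) (r' * (r * l))
        (by simp [hr₀, h₀, hr₀']) (by simp [hr₁, h₁, hr₁'])
        ⟨_, hu.form (ω := ω) continuous_const⟩ ⟨_, Continuous.form (ω := ω) continuous_const hu⟩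
        hne hpl
      obtain ⟨q, hq₀, hq₁, hq, hqf⟩ := exists_mul_smul_right_eq (i := i) (R⁻¹ * (r' * (r * l)))
        (by simp [hr₀, h₀, hr₀', hR₀]) (by simp [hr₁, h₁, hr₁', hR₁])
        (fun s => mul_mem (inv_mem (hRf s)) (mul_mem (hrf' s) (mul_mem (hrf s) (hl s)))) hRe
      obtain ⟨b, hb⟩ := ih (k + 1) (by omega) (q * (R⁻¹ * (r' * (r * l))))
        (by simp [hr₀, h₀, hr₀', hR₀, hq₀]) (by simp [hr₁, h₁, hr₁', hR₁, hq₁]) hqf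
      refine ⟨a + b, ?_⟩
      have : mk q hq₀ * ((mk R hR₀)⁻¹ * (mk r' hr₀' * (mk r hr₀ * mk l h₀))) = rotClass h b := hb
      rw [hq, hr', hr, ha, one_mul, one_mul, one_mul, inv_mul_eq_iff_eq_mul] at this
      rw [this, rotClass_add, rotClass_eq _ h]
  induction z using ind_mk with | h l hl => ?_
  exact key n 0 (zero_add n) l hl hz fun s => B.fixer_zero _

end SpGroup

end

/-! ### The phase of a Lagrangian subspace and its winding number -/

noncomputable section

variable {V : Type*} [AddCommGroup V] [Module ℝ V] {ω : LinearMap.BilinForm ℝ V}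

namespace SymplecticBasis

variable {n : ℕ} (B : SymplecticBasis ω n)

/-- The image of a symplectic basis under a symplectic map. -/
def map (g : SpGroup ω) : SymplecticBasis ω n where
  e i := g • B.e i
  f i := g • B.f i
  form_e_e i j := by rw [SpGroup.form_smul_smul, B.form_e_e]
  form_f_f i j := by rw [SpGroup.form_smul_smul, B.form_f_f]
  form_e_f i j := by rw [SpGroup.form_smul_smul, B.form_e_f]
  expand x := by
    have h := congrArg (g • ·) (B.expand (g⁻¹ • x))
    simp only [smul_inv_smul, Finset.smul_sum, smul_add, smul_comm g] at h
    refine h.trans (Finset.sum_congr rfl fun i _ => ?_)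
    rw [SpGroup.smul_form_left, ← SpGroup.form_smul_smul g (B.e i), smul_inv_smul]

theorem linearIndependent_e : LinearIndependent ℝ B.e := by
  rw [Fintype.linearIndependent_iff]
  intro c hc j
  have h := congrArg (fun v => ω v (B.f j)) hc
  simpa [LinearMap.sum_apply, B.form_e_f] using h

/-- The coordinates of a vector with respect to the complex basis `e₁, …, eₙ`, where `f = i e`. -/
def coord (v : V) (i : Fin n) : ℂ := ω v (B.f i) + ω (B.e i) v * Complex.I

/-- The complex determinant of a family of vectors. -/
def frameDet (c : Fin n → V) : ℂ := (Matrix.of fun i j => B.coord (c j) i).det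

theorem coord_sum_smul {ι : Type*} (s : Finset ι) (a : ι → ℝ) (c : ι → V) (i : Fin n) :
    B.coord (∑ k ∈ s, a k • c k) i = ∑ k ∈ s, B.coord (c k) i * a k := by
  simp only [coord, map_sum, map_smul, LinearMap.sum_apply, LinearMap.smul_apply, smul_eq_mul]
  push_cast
  rw [Finset.sum_mul, ← Finset.sum_add_distrib]
  exact Finset.sum_congr rfl fun k _ => by ring

/-- Frames of the same Lagrangian subspace have proportional determinants. -/
theorem exists_frameDet_eq_mul {c c' : Fin n → V}
    (h : Submodule.span ℝ (Set.range c') ≤ Submodule.span ℝ (Set.range c)) :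
    ∃ r : ℝ, B.frameDet c' = B.frameDet c * r := by
  have hM : ∀ j, ∃ m : Fin n → ℝ, ∑ k, m k • c k = c' j := fun j =>
    Submodule.mem_span_range_iff_exists_fun _ |>.1 (h (Submodule.subset_span ⟨j, rfl⟩))
  choose m hm using hM
  refine ⟨(Matrix.of fun k j => m j k).det, ?_⟩
  rw [frameDet, frameDet, show (((Matrix.of fun k j => m j k).det : ℝ) : ℂ) =
    ((Matrix.of fun k j => m j k).map Complex.ofRealHom).det from
      RingHom.map_det Complex.ofRealHom _, ← Matrix.det_mul]
  congr 1
  ext i j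
  simp [Matrix.mul_apply, ← hm j, coord_sum_smul]

theorem continuous_frameDet [FiniteDimensional ℝ V] (c : Fin n → V) :
    Continuous fun g : SpGroup ω => B.frameDet fun i => g • c i := by
  let _ : TopologicalSpace V := moduleTopology ℝ V
  have : IsModuleTopology ℝ V := ⟨rfl⟩
  refine Continuous.matrix_det (continuous_matrix fun i j => ?_)
  have h : Continuous fun g : SpGroup ω => g • c j := by fun_prop
  exact (Complex.continuous_ofReal.comp (h.form continuous_const)).add
    ((Complex.continuous_ofReal.comp (continuous_const.form h)).mul continuous_const)

variable [IsSymplecticForm ω]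

theorem form_eq_sum (x y : V) :
    ω x y = ∑ i, (ω x (B.f i) * ω (B.e i) y - ω (B.e i) x * ω y (B.f i)) := by
  conv_lhs => rw [B.expand x]
  simp [LinearMap.sum_apply, form_swap (ω := ω) (B.f _) y, sub_eq_add_neg]

/-- An isotropic subspace is totally real. A complex relation among the `c j` yields real
combinations `x` and `y` with `x + Jy = 0`. Then `ω(x, y)` is the sum of the squared coordinates of
`y`, yet it vanishes by isotropy. -/
theorem frameDet_ne_zero {c : Fin n → V} (hc : ∀ i j, ω (c i) (c j) = 0)
    (hli : LinearIndependent ℝ c) : B.frameDet c ≠ 0 := by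
  intro h
  obtain ⟨v, hv, hMv⟩ := Matrix.exists_mulVec_eq_zero_iff.2 h
  refine hv ?_
  set x := ∑ j, (v j).re • c j with hx
  set y := ∑ j, (v j).im • c j with hy
  have hκ : ∀ i, B.coord x i + B.coord y i * Complex.I = 0 := fun i => by
    refine Eq.trans ?_ (congrFun hMv i)
    rw [hx, hy, coord_sum_smul, coord_sum_smul, Finset.sum_mul,
      ← Finset.sum_add_distrib]
    refine Finset.sum_congr rfl fun j _ => ?_
    rw [mul_assoc, ← mul_add]
    exact congrArg (B.coord (c j) i * ·) (Complex.re_add_im (v j))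
  have h₁ : ∀ i, ω x (B.f i) = ω (B.e i) y := fun i => by
    simpa [coord, sub_eq_zero, ← sub_eq_add_neg] using congrArg Complex.re (hκ i)
  have h₂ : ∀ i, ω (B.e i) x = -ω y (B.f i) := fun i => by
    simpa [coord, ← eq_neg_iff_add_eq_zero] using congrArg Complex.im (hκ i)
  have hxy : ω x y = 0 := by simp [hx, hy, LinearMap.sum_apply, hc]
  have hy0 : y = 0 := by
    refine B.eq_zero_of_form_complexStructure ?_
    rw [form_complexStructure_self, ← hxy, B.form_eq_sum x y]
    exact Finset.sum_congr rfl fun i _ => by rw [h₁, h₂]; ring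
  have hx0 : x = 0 := by
    rw [B.expand x]
    exact Finset.sum_eq_zero fun i _ => by simp [h₁, h₂, hy0]
  have hre := Fintype.linearIndependent_iff.1 hli _ (hx.symm.trans hx0)
  have him := Fintype.linearIndependent_iff.1 hli _ (hy.symm.trans hy0)
  ext j
  exact Complex.ext (hre j) (him j)

end SymplecticBasis

namespace Lagrangian

variable [IsSymplecticForm ω] [FiniteDimensional ℝ V] {n : ℕ}

/-- The squared phase of the determinant of a frame of a Lagrangian subspace. -/
def phase (B : SymplecticBasis ω n) (hn : Module.finrank ℝ V = 2 * n) (L : Lagrangian ω) : ℂ :=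
  B.frameDet (L.exists_symplecticBasis hn).choose.e ^ 2 /
    ‖B.frameDet (L.exists_symplecticBasis hn).choose.e‖ ^ 2

variable (B : SymplecticBasis ω n) (hn : Module.finrank ℝ V = 2 * n)

theorem phase_ne_zero (L : Lagrangian ω) : phase B hn L ≠ 0 := by
  have h := B.frameDet_ne_zero (L.exists_symplecticBasis hn).choose.form_e_e
    (L.exists_symplecticBasis hn).choose.linearIndependent_e
  have h' := norm_ne_zero_iff.2 h
  refine div_ne_zero (pow_ne_zero _ h) (pow_ne_zero _ ?_)
  exact_mod_cast h'

/-- Independence of the frame: a change of frame multiplies the determinant by a real number of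
either sign, which cancels once the determinant is squared and normalised. -/
theorem phase_eq (L : Lagrangian ω) (C : SymplecticBasis ω n)
    (hC : Submodule.span ℝ (Set.range C.e) = L.1) :
    phase B hn L = B.frameDet C.e ^ 2 / ‖B.frameDet C.e‖ ^ 2 := by
  obtain ⟨r, hr⟩ := B.exists_frameDet_eq_mul (c := (L.exists_symplecticBasis hn).choose.e)
    (c' := C.e) (by rw [hC, (L.exists_symplecticBasis hn).choose_spec])
  have h := B.frameDet_ne_zero C.form_e_e C.linearIndependent_e
  rw [hr] at h
  have hr0 : (r : ℂ) ≠ 0 := right_ne_zero_of_mul h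
  rw [hr, phase, norm_mul, mul_pow, Complex.norm_real, Real.norm_eq_abs, Complex.ofReal_mul,
    mul_pow, ← Complex.ofReal_pow |r|, sq_abs, Complex.ofReal_pow, mul_div_mul_right]
  exact pow_ne_zero _ hr0

theorem phase_smul (g : SpGroup ω) (L : Lagrangian ω) (C : SymplecticBasis ω n)
    (hC : Submodule.span ℝ (Set.range C.e) = L.1) :
    phase B hn (g • L) =
      B.frameDet (fun i => g • C.e i) ^ 2 / ‖B.frameDet fun i => g • C.e i‖ ^ 2 := by
  refine phase_eq B hn _ (C.map g) ?_
  rw [smul_val, ← hC, Submodule.map_span, ← Set.range_comp]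
  rfl

/-- The Grassmannian carries the topology of the orbit maps, and along an orbit a fixed frame is
carried along by `g`. -/
theorem continuous_phase : Continuous (phase B hn) := by
  refine continuous_iSup_dom.2 fun L => continuous_coinduced_dom.2 ?_
  obtain ⟨C, hC⟩ := L.exists_symplecticBasis hn
  refine Continuous.congr ?_ fun g => (phase_smul B hn g L C hC).symm
  have h := B.continuous_frameDet C.e
  refine (h.pow 2).div ((Complex.continuous_ofReal.comp h.norm).pow 2) fun g => ?_
  have := norm_ne_zero_iff.2 (B.frameDet_ne_zero (C.map g).form_e_e (C.map g).linearIndependent_e)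
  refine pow_ne_zero _ ?_
  exact_mod_cast this

/-- The coordinate matrix of the turned frame is diagonal with one entry `exp(iθ)`; squaring doubles
the angle. -/
theorem phase_planePolar_smul (L : Lagrangian ω) (hB : Submodule.span ℝ (Set.range B.e) = L.1)
    (i : Fin n) (θ : ℝ) :
    phase B hn (SpGroup.planePolar ω (B.e i) (B.f i) (B.form_e_f_self i) 0 θ • L) =
      Complex.exp (2 * θ * Complex.I) := by
  rw [phase_smul B hn _ L B hB]
  have : B.frameDet (fun j => SpGroup.planePolar ω (B.e i) (B.f i) (B.form_e_f_self i) 0 θ • B.e j)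
      = Complex.exp (θ * Complex.I) := by
    have hd : (Matrix.of fun k j => B.coord
        (SpGroup.planePolar ω (B.e i) (B.f i) (B.form_e_f_self i) 0 θ • B.e j) k) =
        Matrix.diagonal fun j => if j = i then Complex.exp (θ * Complex.I) else 1 := by
      ext k j
      simp only [Matrix.of_apply, Matrix.diagonal_apply, SymplecticBasis.coord,
        SpGroup.planePolar, SpGroup.planeMap_smul, Complex.exp_mul_I]
      by_cases hj : j = i
      · subst hj
        by_cases hk : k = j
        · subst hk
          simp [B.form_e_e, B.form_e_f, B.form_f_f]
        · simp [B.form_e_e, B.form_e_f, B.form_f_f, hk, Ne.symm hk]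
      · by_cases hk : k = j
        · subst hk
          simp [B.form_e_e, B.form_e_f, hj]
        · simp [B.form_e_e, B.form_e_f, hk, hj, Ne.symm hk]
    rw [SymplecticBasis.frameDet, hd, Matrix.det_diagonal]
    simp
  rw [this, Complex.norm_exp_ofReal_mul_I, ← Complex.exp_nat_mul]
  simp
  ring_nf

end Lagrangian

namespace SpGroup

open UniversalCover

variable [IsSymplecticForm ω] [FiniteDimensional ℝ V]

/-- Nontrivial rotations act without fixed points on the universal cover of the Lagrangian
Grassmannian. -/
theorem eq_zero_of_rotClass_smul {e f : V} (h : ω e f = 1) {m : ℤ} {L₀ : Lagrangian ω}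
    {x : LagrangianTilde L₀} (hx : rotClass h m • x = x) : m = 0 := by
  obtain ⟨n, hn⟩ : ∃ n, Module.finrank ℝ V = 2 * n := ⟨_, L₀.two_mul_finrank.symm⟩
  obtain ⟨B, hB⟩ := L₀.exists_symplecticBasis hn
  have hn0 : 0 < n := by
    by_contra! h0
    have : IsEmpty (Fin n) := by
      rw [Nat.le_zero.1 h0]
      infer_instance
    exact ne_zero_of_form_eq_one h (by rw [B.expand e]; simp)
  let i : Fin n := ⟨0, hn0⟩
  rw [rotClass_eq h (B.form_e_f_self i)] at hx
  induction x using ind_mk with | h δ hδ => ?_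
  rw [rotClass, mk_smul_mk] at hx
  obtain ⟨H⟩ := homotopicRel_of_mk_eq hx
  set R := rotPath (B.form_e_f_self i) m with hR
  have hR0 : R 0 = 1 := rotPath_zero _ m
  have hR1 : R 1 = 1 := rotPath_one _ m
  have hc := Lagrangian.continuous_phase B hn
  have hc' := Lagrangian.phase_ne_zero B hn
  have hrat : ∀ {T : Type} [TopologicalSpace T] {a b : T → Lagrangian ω}, Continuous a →
      Continuous b → Continuous fun t => (⟨Lagrangian.phase B hn (a t) /
        Lagrangian.phase B hn (b t), div_ne_zero (hc' _) (hc' _)⟩ : {z : ℂ // z ≠ 0}) :=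
    fun ha hb => ((hc.comp ha).div (hc.comp hb) fun _ => hc' _).subtype_mk _
  -- The quotient of the phases of `R s • L` and `L` is a loop even when `L` varies along `δ`. It is
  -- compared for `L` constant (`γ₀`), for `L = δ s` (`γ₁`), and with the constant loop (`γ₂`).
  let γ₀ : C(I, {z : ℂ // z ≠ 0}) := ⟨_, hrat (a := fun s => R s • L₀) (b := fun _ => L₀)
    (by fun_prop) continuous_const⟩
  let γ₁ : C(I, {z : ℂ // z ≠ 0}) := ⟨_, hrat (a := fun s => R s • δ s) (b := fun s => δ s)
    (by fun_prop) (by fun_prop)⟩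
  let γ₂ : C(I, {z : ℂ // z ≠ 0}) := ContinuousMap.const I ⟨1, one_ne_zero⟩
  have h0 : γ₀ 0 = ⟨1, one_ne_zero⟩ := Subtype.ext (by simp [γ₀, hR0, hc'])
  have h1 : γ₁ 0 = ⟨1, one_ne_zero⟩ := Subtype.ext (by simp [γ₁, hR0, hc'])
  -- The subspace is moved from `L₀` to `δ s` along `δ (t * s)`; at the right end `R 1 = 1`, so the
  -- quotient stays `1`.
  have e₁ : mk γ₀ h0 = mk γ₁ h1 := by
    refine mk_eq_of_homotopy (fun t s => ⟨Lagrangian.phase B hn (R s • δ (t * s)) /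
      Lagrangian.phase B hn (δ (t * s)), div_ne_zero (hc' _) (hc' _)⟩)
      (hrat (T := I × I) (by fun_prop) (by fun_prop)) ?_ ?_ ?_ ?_
    · intro s; simp [γ₀, hδ]
    · intro s; simp [γ₁]
    · intro t; simp [hR0, hc']
    · intro t; simp [hR1, hc', γ₀]
  have e₂ : mk γ₁ h1 = mk γ₂ rfl := by
    refine mk_eq_of_homotopy (fun t s => ⟨Lagrangian.phase B hn (H (t, s)) /
      Lagrangian.phase B hn (δ s), div_ne_zero (hc' _) (hc' _)⟩)
      (hrat (T := I × I) (map_continuous H) (by fun_prop)) ?_ ?_ ?_ ?_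
    · intro s
      exact Subtype.ext (congrArg (fun L => Lagrangian.phase B hn L / Lagrangian.phase B hn (δ s))
        (H.apply_zero s))
    · intro s; simp [γ₂, hc']
    · intro t
      have : H (t, 0) = δ 0 := (H.eq_fst t (by simp)).trans (by simp [pathSMul, hR0])
      simp [this, hc']
    · intro t
      have : H (t, 1) = δ 1 := (H.eq_fst t (by simp)).trans (by simp [pathSMul, hR1])
      simp [this, hc', γ₁, hR1]
  have key := homotopicRel_of_mk_eq (e₁.trans e₂)
  -- The phase is a squared determinant, so `m` turns wind `2m` times.
  have h2m : 2 * m = 0 := by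
    refine eq_zero_of_homotopicRel (fun s => ?_) (fun s => rfl) key
    have h₁ := Lagrangian.phase_planePolar_smul B hn L₀ hB i (2 * Real.pi * m * s)
    have h₂ := Lagrangian.phase_planePolar_smul B hn L₀ hB i 0
    rw [planePolar_zero_of_cos_eq_one _ Real.cos_zero, one_smul] at h₂
    change Lagrangian.phase B hn (R s • L₀) / Lagrangian.phase B hn L₀ = _
    rw [hR, rotPath_apply, h₁, h₂]
    simp
    ring_nf
  omega

/-- The kernel of the universal cover acts freely on the universal cover of the Lagrangian
Grassmannian. -/
theorem eq_one_of_mem_ker_of_smul {z : SpTilde ω} (hz : z ∈ (projHom (SpGroup ω)).ker)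
    {e f : V} (h : ω e f = 1) {L₀ : Lagrangian ω} {x : LagrangianTilde L₀} (hx : z • x = x) :
    z = 1 := by
  obtain ⟨m, rfl⟩ := exists_eq_rotClass h hz
  rw [eq_zero_of_rotClass_smul h hx]
  simpa using rotClass_add h 0 0

theorem rotClass_injective {e f : V} (h : ω e f = 1) {m : ℤ} (hm : rotClass h m = 1) : m = 0 := by
  obtain ⟨L₀⟩ := Lagrangian.nonempty (ω := ω)
  exact eq_zero_of_rotClass_smul h (x := mk (ContinuousMap.const I L₀) rfl) (by rw [hm, one_smul])

end SpGroup

end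

/-! ### Canonical lifts of transvections -/

noncomputable section

variable {V : Type*} [AddCommGroup V] [Module ℝ V] {ω : LinearMap.BilinForm ℝ V}

theorem UniversalCover.proj_smul {G X : Type*} [Group G] [TopologicalSpace G]
    [IsTopologicalGroup G] [TopologicalSpace X] [MulAction G X] [ContinuousSMul G X] {x₀ : X}
    (q : UniversalCover G (1 : G)) (x : UniversalCover X x₀) :
    proj (q • x) = projHom G q • proj x := by
  induction q using ind_mk
  induction x using ind_mk
  rfl

namespace SpGroup

open UniversalCover

variable [IsSymplecticForm ω] [FiniteDimensional ℝ V]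

theorem continuous_shear_const (a : V) {T : Type*} [TopologicalSpace T] {c : T → ℝ}
    (hc : Continuous c) : Continuous fun t => shear ω a (c t) := by
  let _ : TopologicalSpace V := moduleTopology ℝ V
  have : IsModuleTopology ℝ V := ⟨rfl⟩
  exact continuous_shear continuous_const hc

theorem conj_shear (g : SpGroup ω) (a : V) (c : ℝ) :
    g * shear ω a c * g⁻¹ = shear ω (g • a) c := by
  rw [mul_inv_eq_iff_eq_mul]
  refine ext_smul fun x => ?_
  simp only [mul_smul, shear_smul, smul_add, form_smul_smul, smul_comm g]

variable (ω) in
/-- The path of transvections from the identity to the transvection in `a`. -/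
def shearPath (a : V) : C(I, SpGroup ω) :=
  ⟨fun s => shear ω a s, continuous_shear_const a continuous_subtype_val⟩

theorem shearPath_apply (a : V) (s : I) : shearPath ω a s = shear ω a s := rfl

theorem shearPath_zero (a : V) : shearPath ω a 0 = 1 := shear_zero a

variable (ω) in
/-- The canonical lift of a transvection to the universal cover of the symplectic group. -/
def shearLift (a : V) : SpTilde ω := mk (shearPath ω a) (shearPath_zero a)

theorem projHom_shearLift (a : V) : projHom (SpGroup ω) (shearLift ω a) = shear ω a 1 := rfl

/-- Transvections are quadratic in their vector. This absorbs the sign that appears in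
`shearLift_braid`. -/
theorem shearLift_neg (a : V) : shearLift ω (-a) = shearLift ω a := by
  unfold shearLift
  congr 1
  ext1 s
  refine ext_smul fun x => ?_
  simp [shearPath_apply, shear_smul]

theorem shearLift_mul_comm {a b : V} (h : ω a b = 0) :
    shearLift ω a * shearLift ω b = shearLift ω b * shearLift ω a := by
  have h' : ω b a = 0 := by rw [form_swap, h, neg_zero]
  rw [shearLift, shearLift, mk_mul_mk, mk_mul_mk]
  congr 1
  ext1 s
  refine ext_smul fun x => ?_
  simp only [ContinuousMap.mul_apply, shearPath_apply, mul_smul, shear_smul, map_add, map_smul, h,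
    h', smul_zero, add_zero]
  abel

/-- Pointwise conjugation gives the path `shear (γ s • a) s`. The argument of `γ` can be slid from
`s` to `1`: at `s = 0` the shear is trivial for any vector, and at `s = 1` nothing moves. -/
theorem conj_shearLift (x : SpTilde ω) (a : V) :
    x * shearLift ω a * x⁻¹ = shearLift ω (projHom (SpGroup ω) x • a) := by
  let _ : TopologicalSpace V := moduleTopology ℝ V
  have : IsModuleTopology ℝ V := ⟨rfl⟩
  induction x using ind_mk with | h γ hγ => ?_
  rw [projHom_mk, shearLift, shearLift, mk_inv, mk_mul_mk, mk_mul_mk]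
  refine mk_eq_of_homotopy
    -- The number `s + t * (1 - s)` already lies in the interval; `Set.projIcc` only gives it the
    -- right type.
    (fun t s => shear ω (γ (Set.projIcc 0 1 zero_le_one (s + t * (1 - s))) • a) s) ?_ ?_ ?_ ?_ ?_
  · exact continuous_shear (T := I × I) (a := fun p =>
      γ (Set.projIcc 0 1 zero_le_one ((p.2 : ℝ) + p.1 * (1 - p.2))) • a) (c := fun p => (p.2 : ℝ))
      (by fun_prop) (by fun_prop)
  · intro s
    simp [conj_shear, shearPath_apply]
  · intro s
    simp [shearPath_apply]
  · intro t
    simp [shear_zero]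
  · intro t
    simp [conj_shear, shearPath_apply]

/-- The product of the transvections in `a` and `b` maps `a` to `-b` or `b`, so by `conj_shearLift`
the product of the lifts conjugates the lift for `a` into the lift for `b`. -/
theorem shearLift_braid {a b : V} (h : ω a b = 1 ∨ ω a b = -1) :
    shearLift ω a * shearLift ω b * shearLift ω a =
      shearLift ω b * shearLift ω a * shearLift ω b := by
  have key := conj_shearLift (shearLift ω a * shearLift ω b) a
  have : shearLift ω (projHom (SpGroup ω) (shearLift ω a * shearLift ω b) • a) =
      shearLift ω b := by
    rw [map_mul, projHom_shearLift, projHom_shearLift, mul_smul, shear_smul, shear_smul]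
    rcases h with h | h
    · rw [← shearLift_neg b]
      congr 1
      simp [form_swap (ω := ω) b a, h, form_self]
    · congr 1
      simp [form_swap (ω := ω) b a, h, form_self]
  rw [this, mul_inv_eq_iff_eq_mul] at key
  rw [key, mul_assoc]

/-- The canonical lift of a transvection fixes all points over Lagrangian subspaces that contain
its vector. -/
theorem shearLift_smul {a : V} {L₀ : Lagrangian ω} {x : LagrangianTilde L₀} (h : a ∈ (proj x).1) :
    shearLift ω a • x = x := by
  induction x using ind_mk with | h δ hδ => ?_
  have hfix : ∀ c : ℝ, shear ω a c • δ 1 = δ 1 := by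
    have hle : ∀ c : ℝ, (shear ω a c • δ 1).1 ≤ (δ 1).1 := by
      rintro c _ ⟨y, hy, rfl⟩
      change shear ω a c • y ∈ _
      rw [shear_smul]
      exact add_mem hy (Submodule.smul_mem _ _ h)
    intro c
    refine Subtype.ext (le_antisymm (hle c) fun y hy => ?_)
    refine ⟨shear ω a (-c) • y, hle (-c) (Lagrangian.smul_mem_smul hy), ?_⟩
    change shear ω a c • shear ω a (-c) • y = y
    simp [shear_smul, form_self]
  rw [shearLift, mk_smul_mk]
  symm
  -- The right end does not move, since every shear along `a` fixes the Lagrangian subspace `δ 1`,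
  -- which contains `a`.
  refine mk_eq_of_homotopy (fun t s => shear ω a (t * s) • δ s) ?_ ?_ ?_ ?_ ?_
  · have := continuous_shear_const (ω := ω) (T := I × I) a
      (c := fun p => (p.1 : ℝ) * p.2) (by fun_prop)
    exact this.smul (by fun_prop)
  · intro s; simp [shear_zero]
  · intro s; simp [pathSMul, shearPath_apply]
  · intro t; simp [shear_zero, hδ]
  · intro t; simp [hfix]

/-- Either `a` is orthogonal to `L`, hence in `L`, or some `x` in `L` is moved by a nonzero multiple
of `a`, which is then a difference of elements of `L`. -/
theorem mem_of_shear_smul {a : V} {L : Lagrangian ω} (h : shear ω a 1 • L = L) : a ∈ L.1 := by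
  by_cases H : ∀ x ∈ L.1, ω x a = 0
  · exact L.mem_of_form_eq_zero H
  · push Not at H
    obtain ⟨x, hx, hxa⟩ := H
    have h₁ : shear ω a 1 • x ∈ L.1 := by
      rw [← h]
      exact Lagrangian.smul_mem_smul hx
    rw [shear_smul, one_mul] at h₁
    have h₂ : ω a x • a ∈ L.1 := by simpa using sub_mem h₁ hx
    rw [form_swap, neg_smul, neg_mem_iff] at h₂
    exact (Submodule.smul_mem_iff _ hxa).1 h₂

/-- Every vector lies in a Lagrangian subspace that underlies a point of the universal cover. -/
theorem exists_mem_proj (a : V) (L₀ : Lagrangian ω) : ∃ x : LagrangianTilde L₀, a ∈ (proj x).1 := by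
  obtain ⟨n, hn⟩ : ∃ n, Module.finrank ℝ V = 2 * n := ⟨_, L₀.two_mul_finrank.symm⟩
  obtain ⟨B, hB⟩ := L₀.exists_symplecticBasis hn
  by_cases ha : a = 0
  · exact ⟨mk (ContinuousMap.const I L₀) rfl, ha ▸ zero_mem _⟩
  · obtain ⟨i⟩ : Nonempty (Fin n) := by
      by_contra! H
      exact ha (by rw [B.expand a]; simp)
    obtain ⟨g, -, ⟨p⟩, hg⟩ := exists_smul_eq B (B.tail_zero (B.e i)) (B.tail_zero a)
      (ne_zero_of_form_eq_one (B.form_e_f_self i)) ha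
    refine ⟨mk ⟨fun s => p s • L₀, by fun_prop⟩ (by simp), ?_⟩
    rw [proj_mk]
    simp only [ContinuousMap.coe_mk, p.target]
    rw [← hg]
    refine Lagrangian.smul_mem_smul ?_
    rw [← hB]
    exact Submodule.subset_span ⟨i, rfl⟩

theorem isFixedPointLift_shearLift (a : V) (L₀ : Lagrangian ω) :
    IsFixedPointLift L₀ (shear ω a 1) (shearLift ω a) := by
  obtain ⟨x, hx⟩ := exists_mem_proj a L₀
  exact ⟨projHom_shearLift a, x, shearLift_smul hx⟩

/-- The point fixed by `q` lies over a Lagrangian subspace that contains `a`, so the canonical lift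
fixes the same point. The quotient of the two lifts is in the kernel, which acts freely. -/
theorem eq_shearLift {e f : V} (h : ω e f = 1) {a : V} {L₀ : Lagrangian ω} {q : SpTilde ω}
    (hq : IsFixedPointLift L₀ (shear ω a 1) q) : q = shearLift ω a := by
  obtain ⟨hq, x, hx⟩ := hq
  have hmem : a ∈ (proj x).1 := mem_of_shear_smul (by rw [← hq, ← proj_smul, hx])
  refine mul_inv_eq_one.1 (eq_one_of_mem_ker_of_smul (x := x) ?_ h ?_)
  · rw [MonoidHom.mem_ker, map_mul, map_inv, hq, projHom_shearLift, mul_inv_cancel]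
  · rw [mul_smul, inv_smul_eq_iff.2 (shearLift_smul hmem).symm, hx]

variable (ω) in
/-- The central extension of the symplectic group by its fundamental group. -/
def universalExtension {e f : V} (h : ω e f = 1) :
    GroupExtension (Multiplicative ℤ) (SpTilde ω) (SpGroup ω) where
  inl := MonoidHom.mk' (fun m => rotClass h m.toAdd) fun _ _ => rotClass_add h _ _
  rightHom := projHom (SpGroup ω)
  inl_injective := (injective_iff_map_eq_one _).2 fun _ hm => rotClass_injective h hm
  range_inl_eq_ker_rightHom := by
    ext z
    constructor
    · rintro ⟨m, rfl⟩
      exact rotClass_mem_ker h _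
    · intro hz
      obtain ⟨m, rfl⟩ := exists_eq_rotClass h hz
      exact ⟨Multiplicative.ofAdd m, rfl⟩
  rightHom_surjective := projHom_surjective (joined_one ω)

end SpGroup

/-! ### Extension of scalars from the integers to the reals -/

section Integral

variable {H : Type*} [AddCommGroup H] {θ : LinearMap.BilinForm ℤ H}

theorem form_baseChange_one_tmul (x y : H) :
    θ.baseChange ℝ (1 ⊗ₜ x) (1 ⊗ₜ y) = θ x y := by
  simp

/-- Over the reals antisymmetry implies alternation. By unimodularity each coordinate function of an
integral basis is the pairing with a vector of `H`, so a vector in the radical has zero coordinates.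
-/
theorem isSymplecticForm_baseChange [Module.Free ℤ H] [Module.Finite ℤ H] (hθ : θ.IsAlt)
    (h : θ.IsPerfPair) : IsSymplecticForm (θ.baseChange ℝ) where
  isAlt := by
    have hs : ∀ x y, θ.baseChange ℝ x y = -θ.baseChange ℝ y x := by
      intro x y
      induction x using TensorProduct.induction_on with
      | zero => simp
      | add x₁ x₂ h₁ h₂ =>
        simp only [map_add, LinearMap.add_apply, h₁, h₂]
        ring
      | tmul r x =>
        induction y using TensorProduct.induction_on with
        | zero => simp
        | add y₁ y₂ h₁ h₂ =>
          simp only [map_add, LinearMap.add_apply, h₁, h₂]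
          ring
        | tmul s y =>
          simp only [LinearMap.BilinForm.baseChange_tmul, ← hθ.neg_eq x y, neg_smul, neg_neg,
            mul_comm r s]
    intro x
    have := hs x x
    linarith
  separating x hx := by
    let b := Module.Free.chooseBasis ℤ H
    refine (b.baseChange ℝ).ext_elem fun j => ?_
    obtain ⟨d, hd⟩ := h.bijective_right.2 (b.coord j)
    have h₁ := hx (1 ⊗ₜ d)
    rw [← (b.baseChange ℝ).sum_repr x] at h₁
    have h₂ : ∀ i, θ (b i) d = b.repr (b i) j := fun i => LinearMap.congr_fun hd (b i)
    simpa [LinearMap.sum_apply, h₂, Finsupp.single_apply] using h₁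

theorem SpGroup.toReal_transvection [Module.Free ℤ H] [Module.Finite ℤ H]
    [IsSymplecticForm (θ.baseChange ℝ)] (hθ : θ.IsAlt) (a : H) :
    SpGroup.toReal θ (SpGroup.transvection hθ a) = SpGroup.shear (θ.baseChange ℝ) (1 ⊗ₜ a) 1 := by
  refine SpGroup.ext_smul fun x => ?_
  rw [SpGroup.shear_smul, one_mul]
  induction x using TensorProduct.induction_on with
  | zero => simp
  | add x y hx hy =>
    rw [smul_add, hx, hy, map_add, add_smul]
    abel
  | tmul r x =>
    change r ⊗ₜ[ℤ] (x + θ a x • a) = _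
    rw [TensorProduct.tmul_add, LinearMap.BilinForm.baseChange_tmul, TensorProduct.smul_tmul',
      ← TensorProduct.smul_tmul]
    simp

end Integral

end

/-! ### The lifted representation of the braid group -/

/-- The homomorphism from the braid group to the universal cover of the symplectic group that sends
the generators to the canonical lifts of transvections. -/
noncomputable def braidToSpTilde {H : Type*} [AddCommGroup H] [Module.Free ℤ H] [Module.Finite ℤ H]
    {θ : LinearMap.BilinForm ℤ H} [IsSymplecticForm (θ.baseChange ℝ)] {n : ℕ}
    {a : Fin (n - 1) → H} (ha : IsCurveChain θ a) : BraidGroup n →* SpTilde (θ.baseChange ℝ) :=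
  PresentedGroup.toGroup (f := fun i => SpGroup.shearLift (θ.baseChange ℝ) (1 ⊗ₜ a i)) (by
    rintro r (⟨i, j, hij, rfl⟩ | ⟨i, j, hij, rfl⟩)
    · simp only [map_mul, map_inv, FreeGroup.lift_apply_of]
      rw [SpGroup.shearLift_mul_comm, mul_inv_cancel]
      rw [form_baseChange_one_tmul, ha.disjoint i j hij, Int.cast_zero]
    · simp only [map_mul, map_inv, FreeGroup.lift_apply_of]
      rw [SpGroup.shearLift_braid, mul_inv_cancel]
      rw [form_baseChange_one_tmul]
      rcases eq_or_eq_neg_of_abs_eq (ha.consecutive i j hij) with h | h <;> simp [h])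

theorem braidToSpTilde_t {H : Type*} [AddCommGroup H] [Module.Free ℤ H] [Module.Finite ℤ H]
    {θ : LinearMap.BilinForm ℤ H} [IsSymplecticForm (θ.baseChange ℝ)] {n : ℕ}
    {a : Fin (n - 1) → H} (ha : IsCurveChain θ a) (i : Fin (n - 1)) :
    braidToSpTilde ha (BraidGroup.t i) = SpGroup.shearLift (θ.baseChange ℝ) (1 ⊗ₜ a i) :=
  PresentedGroup.toGroup.of _

theorem projHom_braidToSpTilde {H : Type*} [AddCommGroup H] [Module.Free ℤ H] [Module.Finite ℤ H]
    {θ : LinearMap.BilinForm ℤ H} [IsSymplecticForm (θ.baseChange ℝ)] (hθ : θ.IsAlt) {n : ℕ}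
    {a : Fin (n - 1) → H} (ha : IsCurveChain θ a) (b : BraidGroup n) :
    UniversalCover.projHom _ (braidToSpTilde ha b) = SpGroup.toReal θ (braidToSp hθ ha b) := by
  refine DFunLike.congr_fun (f := (UniversalCover.projHom _).comp (braidToSpTilde ha))
    (g := (SpGroup.toReal θ).comp (braidToSp hθ ha)) (PresentedGroup.ext fun i => ?_) b
  change UniversalCover.projHom _ (braidToSpTilde ha (BraidGroup.t i)) =
    SpGroup.toReal θ (braidToSp hθ ha (BraidGroup.t i))
  rw [braidToSpTilde_t, braidToSp_t, SpGroup.toReal_transvection, SpGroup.projHom_shearLift]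

theorem proposition4p2 (g : ℕ) (hg : 1 ≤ g)
    {H : Type*} [AddCommGroup H] [Module.Free ℤ H] [Module.Finite ℤ H]
    (hrank : Module.finrank ℤ H = 2 * g)
    (θ : LinearMap.BilinForm ℤ H) (hθ : θ.IsAlt) (hunimodular : θ.IsPerfPair)
    (a : Fin (2 * g + 2 - 1) → H) (ha : IsCurveChain θ a) :
    (∃ E : GroupExtension (Multiplicative ℤ) (SpTilde (θ.baseChange ℝ)) (SpGroup (θ.baseChange ℝ)),
        E.rightHom = UniversalCover.projHom (SpGroup (θ.baseChange ℝ)) ∧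
        E.inl.range ≤ Subgroup.center (SpTilde (θ.baseChange ℝ)) ∧
        Nonempty (E.pullback ((SpGroup.toReal θ).comp
          (braidToSp (n := 2 * g + 2) hθ ha))).Splitting) ∧
    ∃ σt : BraidGroup (2 * g + 2) →* SpTildeInt θ,
      (∀ b : BraidGroup (2 * g + 2),
        UniversalCover.projHom (SpGroup (θ.baseChange ℝ)) (σt b) =
          SpGroup.toReal θ (braidToSp hθ ha b)) ∧
      ∀ (L₀ : Lagrangian (θ.baseChange ℝ)) (i : Fin (2 * g + 2 - 1)),
        IsFixedPointLift L₀ (SpGroup.toReal θ (braidToSp hθ ha (BraidGroup.t i)))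
          (σt (BraidGroup.t i)) ∧
        ∀ q : SpTilde (θ.baseChange ℝ),
          IsFixedPointLift L₀ (SpGroup.toReal θ (braidToSp hθ ha (BraidGroup.t i))) q →
            q = σt (BraidGroup.t i) := by
  have := isSymplecticForm_baseChange hθ hunimodular
  -- The first two elements of the chain form a hyperbolic pair up to sign; they exist because `g ≥
  -- 1`.
  obtain ⟨e, f, h⟩ : ∃ e f, θ.baseChange ℝ e f = 1 := by
    have hc := ha.consecutive ⟨0, by omega⟩ ⟨1, by omega⟩ rfl
    rcases eq_or_eq_neg_of_abs_eq hc with h | h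
    · exact ⟨_, _, (form_baseChange_one_tmul _ _).trans (by rw [h, Int.cast_one])⟩
    · refine ⟨-(1 ⊗ₜ a ⟨0, by omega⟩), 1 ⊗ₜ a ⟨1, by omega⟩, ?_⟩
      rw [map_neg, LinearMap.neg_apply, form_baseChange_one_tmul, h]
      simp
  have hproj := projHom_braidToSpTilde (n := 2 * g + 2) hθ ha
  refine ⟨⟨SpGroup.universalExtension _ h, rfl, ?_, ⟨?_⟩⟩, ?_⟩
  · rw [GroupExtension.range_inl_eq_ker_rightHom]
    exact UniversalCover.ker_projHom_le_center
  -- A lift of `σ` to the universal cover amounts to a section `b ↦ (b, lift of b)` of the fibre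
  -- product.
  · exact
      { toMonoidHom := ((MonoidHom.id _).prod (braidToSpTilde (n := 2 * g + 2) ha)).codRestrict _
          fun b => (hproj b).symm
        rightInverse_rightHom := fun b => rfl }
  · refine ⟨(braidToSpTilde (n := 2 * g + 2) ha).codRestrict _ fun b => ⟨_, (hproj b).symm⟩,
      hproj, fun L₀ i => ?_⟩
    change IsFixedPointLift L₀ _ (braidToSpTilde (n := 2 * g + 2) ha (BraidGroup.t i)) ∧
      ∀ q, _ → q = braidToSpTilde (n := 2 * g + 2) ha (BraidGroup.t i)
    rw [braidToSpTilde_t, braidToSp_t, SpGroup.toReal_transvection]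
    exact ⟨SpGroup.isFixedPointLift_shearLift _ L₀, fun q hq => SpGroup.eq_shearLift h hq⟩
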